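/- **Notation.** Let $\mathbb{H}$ be the quaternions, $\mathbb{B}=\{q\in\mathbb{H}: |q|<1\}$ and $\mathbb{S}=\{I\in\mathbb{H}: I^2=-1\}$. A function $f:\mathbb{B}\to\mathbb{H}$ is *(slice) regular* if, for every $I\in\mathbb{S}$, the map $(x,y)\mapsto f(x+Iy)$ is real differentiable and $\frac12\left(\frac{\partial}{\partial x}+I\frac{\partial}{\partial y}\right)f(x+Iy)=0$ wherever $x+Iy\in\mathbb{B}$. The regular functions on $\mathbb{B}$ are exactly the sums of power series $f(q)=\sum_n q^n a_n$ ($a_n\in\mathbb{H}$) converging in $\mathbb{B}$. For $f(q)=\sum_n q^na_n$ and $g(q)=\sum_n q^nb_n$ put $$f*g(q)=\sum_n q^n\sum_{k=0}^n a_kb_{n-k},\qquad f^c(q)=\sum_n q^n\bar a_n,\qquad f^s=f*f^c,$$ and, where the symmetrization in the denominator does not vanish, $$f^{-*}*g(q)=f^s(q)^{-1}\,(f^c*g)(q),\qquad g*h^{-*}(q)=h^s(q)^{-1}\,(g*h^c)(q),\qquad f^{-*}=f^{-*}*1 .$$ The Cullen derivative is $\partial_cf(x+Iy)=\frac12\left(\frac{\partial}{\partial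 x}-I\frac{\partial}{\partial y}\right)f(x+Iy)$. The spherical derivative is $\partial_sf(q)=(2\,\mathrm{Im}\,q)^{-1}(f(q)-f(\bar q))$ for $q\notin\mathbb{R}$, extended continuously by $\partial_sf(q)=\partial_cf(q)$ for $q\in\mathbb{R}$. For $q_0\in\mathbb{B}$, $R_{q_0}f$ is the regular function on $\mathbb{B}$ that extends $(q-q_0)^{-*}*(f(q)-f(q_0))$ by continuity across the zero set of $(q-q_0)^s$. A *regular Möbius transformation of $\mathbb{B}$* is a function $f$ on $\mathbb{B}$ with $f(\mathbb{B})=\mathbb{B}$ of the form $f(q)=(qc+d)^{-*}*(qa+b)$, where $\begin{bmatrix}a&c\\b&d\end{bmatrix}\in GL(2,\mathbb{H})$ and $(qc+d)^s$ has no zero in $\mathbb{B}$. **Theorem (Schwarz–Pick lemma).** Let $f:\mathbb{B}\to\mathbb{B}$ be a regular function and let $q_0\in\mathbb{B}$. Then $(1-\overline{f(q_0)}*f(q))^s$ and $(1-\bar q_0*q)^s$ have no zeros in $\mathbb{B}$, the function $R_{q_0}f$ is well defined and regular on $\mathbb{B}$, $f^s(q_0)\neq 1$, and for all $q\in\mathbb{B}$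 $$|(f(q)-f(q_0))*(1-\overline{f(q_0)}*f(q))^{-*}|\le|(q-q_0)*(1-\bar q_0*q)^{-*}|,\tag{1}$$ $$|R_{q_0}f(q)*(1-\overline{f(q_0)}*f(q))^{-*}|\le|(1-\bar q_0*q)^{-*}|.\tag{2}$$ Moreover, $$\left|\partial_cf*(1-\overline{f(q_0)}*f)^{-*}\right|_{|_{q_0}}\le\frac1{1-|q_0|^2},\tag{3}$$ $$\frac{|\partial_sf(q_0)|}{|1-f^s(q_0)|}\le\frac1{|1-\overline{q_0}^{\,2}|}.\tag{4}$$ If $f$ is a regular Möbius transformation of $\mathbb{B}$, then equality holds in (1) and (2) for all $q\in\mathbb{B}$, and in (3) and (4). Otherwise, (1) is strict for all $q\in\mathbb{B}\setminus\{q_0\}$, (2) is strict for all $q\in\mathbb{B}$, and (3) and (4) are strict. In all cases both sides of (1) vanish at $q=q_0$. -/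

import Mathlib

open Set Metric

noncomputable section

local notation "ℍ" => Quaternion ℝ

/-- The open unit ball of the quaternions. -/
abbrev unitBall : Set ℍ := ball (0 : ℍ) 1

/-- The sphere of imaginary units, `I ^ 2 = -1`. -/
def imagUnits : Set ℍ := {I | I * I = -1}

/-- The parametrization `(x, y) ↦ x + I y` of the slice `ℝ + I ℝ`. -/
def sliceMap (I : ℍ) (p : ℝ × ℝ) : ℍ := (p.1 : ℍ) + I * (p.2 : ℍ)

/-- The partial derivative in `x` of `(x, y) ↦ f (x + I y)`. -/
def sliceDx (f : ℍ → ℍ) (I : ℍ) (p : ℝ × ℝ) : ℍ :=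
  fderiv ℝ (fun r : ℝ × ℝ => f (sliceMap I r)) p (1, 0)

/-- The partial derivative in `y` of `(x, y) ↦ f (x + I y)`. -/
def sliceDy (f : ℍ → ℍ) (I : ℍ) (p : ℝ × ℝ) : ℍ :=
  fderiv ℝ (fun r : ℝ × ℝ => f (sliceMap I r)) p (0, 1)

/-- Slice regularity on an open set `Ω`: on each slice `f` is real differentiable and satisfies
`(1/2) (∂/∂x + I ∂/∂y) f = 0`. -/
def SliceRegularOn (f : ℍ → ℍ) (Ω : Set ℍ) : Prop :=
  ∀ I ∈ imagUnits, ∀ p : ℝ × ℝ, sliceMap I p ∈ Ω →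
    DifferentiableAt ℝ (fun r : ℝ × ℝ => f (sliceMap I r)) p ∧
      (1 / 2 : ℝ) • (sliceDx f I p + I * sliceDy f I p) = 0

/-- An imaginary unit `I` with `q = Re q + I |Im q|`. At real points, where every `I` is
admissible, the unit `i` is used (for regular functions the Cullen derivative there does not
depend on this choice). -/
def sliceUnit (q : ℍ) : ℍ :=
  open Classical in if q.im = 0 then ⟨0, 1, 0, 0⟩ else (‖q.im‖⁻¹ : ℝ) • q.im

/-- The Cullen derivative `(1/2) (∂/∂x - I ∂/∂y) f` at `q = x + I y`. -/
def cullenDeriv (f : ℍ → ℍ) (q : ℍ) : ℍ :=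
  (1 / 2 : ℝ) • (sliceDx f (sliceUnit q) (q.re, ‖q.im‖) -
    sliceUnit q * sliceDy f (sliceUnit q) (q.re, ‖q.im‖))

/-- The spherical derivative `(2 Im q)⁻¹ (f q - f (conj q))`, extended to real points by
the Cullen derivative (its continuous extension for regular functions). -/
def sphericalDeriv (f : ℍ → ℍ) (q : ℍ) : ℍ :=
  open Classical in
  if q.im = 0 then cullenDeriv f q else (2 * q.im)⁻¹ * (f q - f (star q))

/-- `p` is a power series with `f q = ∑ qⁿ aₙ` on the unit ball. The product of `PowerSeries ℍ`
is `(∑ Xⁿ aₙ) (∑ Xⁿ bₙ) = ∑ Xⁿ ∑_{i + j = n} a_i b_j`. -/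
def HasRegSeries (f : ℍ → ℍ) (p : PowerSeries ℍ) : Prop :=
  ∀ q ∈ unitBall, HasSum (fun n : ℕ => q ^ n * PowerSeries.coeff n p) (f q)

/-- The power series of a function on the unit ball is unique. -/
theorem HasRegSeries.unique {f : ℍ → ℍ} {p p' : PowerSeries ℍ}
    (h : HasRegSeries f p) (h' : HasRegSeries f p') : p = p' := by
  let S : PowerSeries ℍ → FormalMultilinearSeries ℝ ℝ ℍ := fun r n =>
    ContinuousMultilinearMap.mkPiRing ℝ (Fin n) (PowerSeries.coeff n r)
  have hS : ∀ r n, (S r).coeff n = PowerSeries.coeff n r := by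
    intro r n
    simp [S, FormalMultilinearSeries.coeff]
  have key : ∀ r : PowerSeries ℍ, HasRegSeries f r →
      HasFPowerSeriesAt (fun x : ℝ => f (x : ℍ)) (S r) 0 := by
    intro r hr
    refine hasFPowerSeriesAt_iff.2 ?_
    filter_upwards [ball_mem_nhds (0 : ℝ) one_pos] with x hx
    have hx' : (x : ℍ) ∈ unitBall := by simpa [unitBall] using hx
    have := hr _ hx'
    simpa [hS, ← Quaternion.coe_pow, Quaternion.coe_mul_eq_smul] using this
  have e := (key p h).eq_formalMultilinearSeries (key p' h')
  ext1 n
  rw [← hS p n, ← hS p' n, e]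

/-- The power series of a function on the unit ball (the zero series if there is none). -/
def regSeries (f : ℍ → ℍ) : PowerSeries ℍ :=
  open Classical in if h : ∃ p, HasRegSeries f p then h.choose else 0

theorem HasRegSeries.regSeries_eq {f : ℍ → ℍ} {p : PowerSeries ℍ} (h : HasRegSeries f p) :
    regSeries f = p := by
  have hex : ∃ p, HasRegSeries f p := ⟨p, h⟩
  rw [regSeries, dif_pos hex]
  exact hex.choose_spec.unique h

/-- The function `q ↦ ∑ qⁿ aₙ`. -/
def seriesEval (p : PowerSeries ℍ) (q : ℍ) : ℍ := ∑' n : ℕ, q ^ n * PowerSeries.coeff n p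

/-- The regular product `f * g`. -/
def starMul (f g : ℍ → ℍ) : ℍ → ℍ := seriesEval (regSeries f * regSeries g)

/-- The regular conjugate `f^c (q) = ∑ qⁿ (conj aₙ)`. -/
def regConj (f : ℍ → ℍ) : ℍ → ℍ :=
  seriesEval (PowerSeries.mk fun n => star (PowerSeries.coeff n (regSeries f)))

/-- The symmetrization `f^s = f * f^c`. -/
def regSymm (f : ℍ → ℍ) : ℍ → ℍ := starMul f (regConj f)

/-- The left regular quotient `f^{-*} * g`, meaningful where `f^s ≠ 0`. -/
def leftQuot (f g : ℍ → ℍ) (q : ℍ) : ℍ := (regSymm f q)⁻¹ * starMul (regConj f) g q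

/-- The right regular quotient `g * h^{-*}`, meaningful where `h^s ≠ 0`. -/
def rightQuot (g h : ℍ → ℍ) (q : ℍ) : ℍ := (regSymm h q)⁻¹ * starMul g (regConj h) q

/-- The regular reciprocal `f^{-*} = f^{-*} * 1`. -/
def regInv (f : ℍ → ℍ) : ℍ → ℍ := leftQuot f fun _ => 1

/-- The differential quotient `R_{q₀} f = (q - q₀)^{-*} * (f - f q₀)`, extended by continuity
across the sphere of `q₀`, on which the symmetrization of `q - q₀` vanishes. -/
def diffQuot (f : ℍ → ℍ) (q₀ : ℍ) : ℍ → ℍ :=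
  extendFrom {q | q ∈ unitBall ∧ regSymm (fun w => w - q₀) q ≠ 0}
    (leftQuot (fun w => w - q₀) (fun w => f w - f q₀))

/-- The function `1 - (conj a) * f`, with the regular product. -/
def oneSubConjMul (a : ℍ) (f : ℍ → ℍ) (q : ℍ) : ℍ := 1 - starMul (fun _ => star a) f q

/-- `f` is, on the unit ball, a regular Möbius transformation of the ball: a regular fractional
transformation `(q c + d)^{-*} * (q a + b)` with `!![a, c; b, d]` invertible, defined on the whole
ball, which maps the ball onto itself. -/
def IsRegularMobius (f : ℍ → ℍ) : Prop :=
  ∃ A : Matrix (Fin 2) (Fin 2) ℍ, IsUnit A ∧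
    (∀ q ∈ unitBall, regSymm (fun w => w * A 0 1 + A 1 1) q ≠ 0) ∧
    EqOn f (leftQuot (fun w => w * A 0 1 + A 1 1) (fun w => w * A 0 0 + A 1 0)) unitBall ∧
    f '' unitBall = unitBall

end

/-!
# The Schwarz-Pick lemma for slice regular functions on the quaternionic ball

A slice regular function on the ball is the sum of a power series `∑ qⁿ aₙ`
(`SliceRegularOn.exists_hasRegSeries`), so all identities between regular products are identities in
the ring of power series over the quaternions, and values are recovered from the formula
`(f * g)(q) = f(q) g(f(q)⁻¹ q f(q))` (`seriesEval_mul`). Symmetrizations `f^s = f * f^c` have real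
coefficients; they are central, multiply pointwise, and their modulus is constant along conjugates
of a point.

Let `a = f(q₀)` and write `f - a = (q - q₀) * R`, so that `R` is the differential quotient of `f`
at `q₀`. Put `D = 1 - ā * f`, `B = 1 - f ā` and `E = 1 - q q̄₀`. The identities `B^s = D^s` and
`(f - a) * D^c = B^c * (f - a)` show that `(f - a) * D^{-*} = B^{-*} * (f - a)`, and the latter is,
up to a rotation of the variable, the pointwise Möbius transform `(1 - f ā)⁻¹ (f - a)`; hence it has
modulus less than `1` (`norm_seriesEval_sub_C_mul_lt`). Dividing by the Möbius transform
`E^{-*} * (q - q₀)` of the variable, whose modulus tends to `1` at the boundary, gives the regular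
function `G = E * R * D^{-*}`, to which the maximum modulus principle is applied on every slice
(`norm_lt_or_eq_mul_C`): either `|G| < 1` on the ball or `G` is a constant of modulus `1`
(`schwarzPick_dichotomy`).

Each of the four left-hand sides of the theorem is the right-hand side times the modulus of `G` at
some point of the ball (`exists_schwarzPick_factor`). For the first two this is the formula for the
values of a product. The third is the second one at `q₀`, by the Leibniz rule, and the fourth is the
second one at `q̄₀`, because there `R` takes the value `∂ₛ f(q₀)`, the numerator `R * D^c` equals
`(1 - |a|²) R`, and `D^s` has modulus `(1 - |a|²) |1 - f^s(q₀)|`.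

It remains to see that `G` is constant exactly for regular Möbius transformations. If `G = u`, then
`E * (f - a) = (q - q₀) u * D`, which is a linear equation for `f`
(`isRegularMobius_of_eq_mul_C`). Conversely, if `(q c + d) * f = q a' + b`, then the pointwise
Möbius map with the same matrix is a bijection of the ball, hence preserves the unit sphere, and its
matrix is, up to a factor, unitary for the form of signature `(1, 1)`
(`rowsPseudoOrthogonal_of_bijective`). This property persists under composition with the Möbius map
of `a`, and the normal form of such matrices then yields `G = u` (`IsRegularMobius.eq_mul_C`).
-/

noncomputable section

local notation "ℍ" => Quaternion ℝ

open PowerSeries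

/-! ### Conjugation of power series over the quaternions -/

/-- The coefficientwise conjugate `∑ Xⁿ (conj aₙ)` of a power series. -/
def conjSeries (p : PowerSeries ℍ) : PowerSeries ℍ := PowerSeries.mk fun n => star (coeff n p)

@[simp] theorem coeff_conjSeries (p : PowerSeries ℍ) (n : ℕ) :
    coeff n (conjSeries p) = star (coeff n p) := by simp [conjSeries]

@[simp] theorem conjSeries_conjSeries (p : PowerSeries ℍ) : conjSeries (conjSeries p) = p := by
  ext1 n; simp

theorem conjSeries_mul (p p' : PowerSeries ℍ) :
    conjSeries (p * p') = conjSeries p' * conjSeries p := by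
  ext1 n
  rw [coeff_conjSeries, coeff_mul, coeff_mul, star_sum, ← Finset.Nat.sum_antidiagonal_swap]
  simp

theorem conjSeries_add (p p' : PowerSeries ℍ) :
    conjSeries (p + p') = conjSeries p + conjSeries p' := by
  ext1 n; simp

theorem conjSeries_sub (p p' : PowerSeries ℍ) :
    conjSeries (p - p') = conjSeries p - conjSeries p' := by
  ext1 n; simp

@[simp] theorem conjSeries_C (a : ℍ) : conjSeries (C a) = C (star a) := by
  ext1 n; by_cases h : n = 0 <;> simp [coeff_C, h]

@[simp] theorem conjSeries_X : conjSeries (X : PowerSeries ℍ) = X := by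
  ext1 n; by_cases h : n = 1 <;> simp [coeff_X, h]

@[simp] theorem conjSeries_one : conjSeries (1 : PowerSeries ℍ) = 1 := by
  simpa using conjSeries_C 1

/-- A power series all of whose coefficients are real. -/
def IsRealSeries (p : PowerSeries ℍ) : Prop := conjSeries p = p

theorem IsRealSeries.coeff_eq {p : PowerSeries ℍ} (h : IsRealSeries p) (n : ℕ) :
    coeff n p = ((coeff n p).re : ℍ) := by
  have := congrArg (coeff n) h
  rw [coeff_conjSeries] at this
  exact Quaternion.star_eq_self.1 this

theorem IsRealSeries.mul_comm {p : PowerSeries ℍ} (h : IsRealSeries p) (p' : PowerSeries ℍ) :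
    p * p' = p' * p := by
  ext1 n
  rw [coeff_mul, coeff_mul, ← Finset.Nat.sum_antidiagonal_swap]
  refine Finset.sum_congr rfl fun i _ => ?_
  rw [Prod.fst_swap, Prod.snd_swap, h.coeff_eq]
  exact Quaternion.coe_commutes _ _

theorem isRealSeries_mul_conjSeries (p : PowerSeries ℍ) : IsRealSeries (p * conjSeries p) := by
  rw [IsRealSeries, conjSeries_mul, conjSeries_conjSeries]

theorem isRealSeries_add_conjSeries (p : PowerSeries ℍ) : IsRealSeries (p + conjSeries p) := by
  rw [IsRealSeries, conjSeries_add, conjSeries_conjSeries, add_comm]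

theorem conjSeries_mul_self (p : PowerSeries ℍ) : conjSeries p * p = p * conjSeries p := by
  rcases eq_or_ne p 0 with rfl | hp
  · ext1 n; simp
  · refine mul_left_cancel₀ hp ?_
    rw [← mul_assoc, (isRealSeries_mul_conjSeries p).mul_comm]

/-- Both sides are the series of twice the real parts of `conj(a) aₙ`, equivalently of
`aₙ conj(a)`. -/
theorem trace_comm (a : ℍ) (p : PowerSeries ℍ) :
    C (star a) * p + conjSeries p * C a = p * C (star a) + C a * conjSeries p := by
  ext1 n
  simp only [map_add, coeff_C_mul, coeff_mul_C, coeff_conjSeries]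
  ext <;> simp <;> ring

theorem X_sub_C_mul_one_sub {b c : ℍ} (hbc : Commute b c) :
    (X - C b) * (1 - X * C c) = (1 - X * C c) * (X - C b : PowerSeries ℍ) := by
  have h1 : C b * (X * C c) = X * C c * (C b : PowerSeries ℍ) := by
    rw [← mul_assoc, (commute_X (C b)).eq, mul_assoc, mul_assoc, ← map_mul, ← map_mul, hbc.eq]
  have h2 : (X : PowerSeries ℍ) * (X * C c) = X * C c * X := by
    rw [mul_assoc, (commute_X (C c)).eq]
  simp only [sub_mul, mul_sub, one_mul, mul_one, h1, h2]
  abel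

/-! ### Convergence and evaluation of power series on the ball -/

theorem mem_unitBall {q : ℍ} : q ∈ unitBall ↔ ‖q‖ < 1 := mem_ball_zero_iff

/-- Convergence of `∑ qⁿ aₙ` on the unit ball, expressed through absolute convergence at all
radii `r < 1`. -/
def ConvOnBall (p : PowerSeries ℍ) : Prop :=
  ∀ r : ℝ, 0 ≤ r → r < 1 → Summable fun n => r ^ n * ‖coeff n p‖

theorem ConvOnBall.summable_norm {p : PowerSeries ℍ} (hp : ConvOnBall p) {q : ℍ}
    (hq : q ∈ unitBall) : Summable fun n => ‖q ^ n * coeff n p‖ := by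
  simpa using hp ‖q‖ (norm_nonneg q) (mem_unitBall.1 hq)

theorem ConvOnBall.hasRegSeries {p : PowerSeries ℍ} (hp : ConvOnBall p) :
    HasRegSeries (seriesEval p) p := fun _ hq => (hp.summable_norm hq).of_norm.hasSum

theorem HasRegSeries.convOnBall {f : ℍ → ℍ} {p : PowerSeries ℍ} (h : HasRegSeries f p) :
    ConvOnBall p := by
  intro r h0 h1
  have := (h (r : ℍ) (by simpa [mem_unitBall, abs_of_nonneg h0] using h1)).summable.norm
  simpa [abs_of_nonneg h0] using this

theorem HasRegSeries.eq_seriesEval {f : ℍ → ℍ} {p : PowerSeries ℍ} (h : HasRegSeries f p) {q : ℍ}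
    (hq : q ∈ unitBall) : f q = seriesEval p q := (h q hq).tsum_eq.symm

theorem HasRegSeries.congr {f g : ℍ → ℍ} {p : PowerSeries ℍ} (h : HasRegSeries f p)
    (hfg : EqOn g f unitBall) : HasRegSeries g p := fun q hq => by
  rw [hfg hq]; exact h q hq

theorem HasRegSeries.sub {f g : ℍ → ℍ} {p p' : PowerSeries ℍ} (h : HasRegSeries f p)
    (h' : HasRegSeries g p') : HasRegSeries (fun q => f q - g q) (p - p') := fun q hq => by
  simpa [mul_sub] using (h q hq).sub (h' q hq)

theorem HasRegSeries.add {f g : ℍ → ℍ} {p p' : PowerSeries ℍ} (h : HasRegSeries f p)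
    (h' : HasRegSeries g p') : HasRegSeries (fun q => f q + g q) (p + p') := fun q hq => by
  simpa [mul_add] using (h q hq).add (h' q hq)

theorem HasRegSeries.mul_C {f : ℍ → ℍ} {p : PowerSeries ℍ} (h : HasRegSeries f p) (a : ℍ) :
    HasRegSeries (fun q => f q * a) (p * C a) := fun q hq => by
  simpa [mul_assoc, coeff_mul_C] using (h q hq).mul_right a

theorem hasRegSeries_C (a : ℍ) : HasRegSeries (fun _ => a) (C a) := fun q _ => by
  convert hasSum_ite_eq 0 a using 2 with n
  by_cases h : n = 0 <;> simp [coeff_C, h]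

theorem hasRegSeries_one : HasRegSeries (fun _ => 1) 1 := hasRegSeries_C 1

theorem hasRegSeries_X : HasRegSeries (fun q => q) X := fun q _ => by
  convert hasSum_ite_eq 1 q using 2 with n
  by_cases h : n = 1 <;> simp [coeff_X, h]

theorem ConvOnBall.conjSeries {p : PowerSeries ℍ} (hp : ConvOnBall p) :
    ConvOnBall (conjSeries p) := fun r h0 h1 => by simpa using hp r h0 h1

theorem ConvOnBall.sub {p p' : PowerSeries ℍ} (hp : ConvOnBall p) (hp' : ConvOnBall p') :
    ConvOnBall (p - p') := (hp.hasRegSeries.sub hp'.hasRegSeries).convOnBall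

theorem ConvOnBall.add {p p' : PowerSeries ℍ} (hp : ConvOnBall p) (hp' : ConvOnBall p') :
    ConvOnBall (p + p') := (hp.hasRegSeries.add hp'.hasRegSeries).convOnBall

theorem convOnBall_C (a : ℍ) : ConvOnBall (C a) := (hasRegSeries_C a).convOnBall

theorem convOnBall_one : ConvOnBall 1 := convOnBall_C 1

theorem convOnBall_X : ConvOnBall X := hasRegSeries_X.convOnBall

theorem ConvOnBall.mul {p p' : PowerSeries ℍ} (hp : ConvOnBall p) (hp' : ConvOnBall p') :
    ConvOnBall (p * p') := by
  intro r h0 h1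
  have key : ∀ s : PowerSeries ℍ, ConvOnBall s → Summable fun n => ‖r ^ n • coeff n s‖ := by
    intro s hs
    simpa [norm_smul, abs_of_nonneg h0] using hs r h0 h1
  refine (summable_norm_sum_mul_antidiagonal_of_summable_norm (key p hp) (key p' hp')).congr ?_
  intro n
  have : ∑ kl ∈ Finset.HasAntidiagonal.antidiagonal n, r ^ kl.1 • coeff kl.1 p * r ^ kl.2 • coeff kl.2 p'
      = r ^ n • coeff n (p * p') := by
    rw [coeff_mul, Finset.smul_sum]
    refine Finset.sum_congr rfl fun kl hkl => ?_
    rw [smul_mul_smul_comm, ← pow_add, Finset.HasAntidiagonal.mem_antidiagonal.1 hkl]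
  rw [this, norm_smul, norm_pow, Real.norm_of_nonneg h0]

/-- The value of a regular product: `(f * g)(q) = ∑ qᵐ f(q) bₘ`. -/
theorem ConvOnBall.hasSum_mul {p p' : PowerSeries ℍ} (hp : ConvOnBall p) (hp' : ConvOnBall p')
    {q : ℍ} (hq : q ∈ unitBall) :
    HasSum (fun m => q ^ m * seriesEval p q * coeff m p') (seriesEval (p * p') q) := by
  let F : ℕ × ℕ → ℍ := fun x => q ^ x.2 * (q ^ x.1 * coeff x.1 p) * coeff x.2 p'
  have hF : Summable F := by
    refine Summable.of_norm ?_
    refine ((hp.summable_norm hq).mul_of_nonneg (hp'.summable_norm hq)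
      (fun _ => norm_nonneg _) fun _ => norm_nonneg _).congr fun x => ?_
    simp only [F, norm_mul, norm_pow]
    ring
  obtain ⟨s, hs⟩ := hF
  have h1 : HasSum (fun m => q ^ m * seriesEval p q * coeff m p') s := by
    refine HasSum.prod_fiberwise ((Equiv.prodComm ℕ ℕ).hasSum_iff.2 hs) fun m => ?_
    exact ((hp.hasRegSeries q hq).mul_left (q ^ m)).mul_right (coeff m p')
  have h2 : HasSum (fun n => q ^ n * coeff n (p * p')) s := by
    refine HasSum.sigma ((Finset.HasAntidiagonal.sigmaAntidiagonalEquivProd).hasSum_iff.2 hs)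
      fun n => ?_
    convert hasSum_fintype _ using 1
    rw [coeff_mul, Finset.mul_sum, Finset.univ_eq_attach,
      ← Finset.sum_attach (Finset.HasAntidiagonal.antidiagonal n)]
    refine Finset.sum_congr rfl fun x _ => ?_
    have hx : q ^ n = q ^ x.1.2 * q ^ x.1.1 := by
      rw [← pow_add, add_comm, Finset.HasAntidiagonal.mem_antidiagonal.1 x.2]
    simp only [F, Function.comp, Finset.HasAntidiagonal.sigmaAntidiagonalEquivProd_apply]
    rw [hx]
    simp only [mul_assoc]
  rwa [h2.unique ((hp.mul hp').hasRegSeries q hq)] at h1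

theorem conj_pow' (h q : ℍ) (hh : h ≠ 0) (n : ℕ) : (h⁻¹ * q * h) ^ n = h⁻¹ * q ^ n * h := by
  induction n with
  | zero => simp [hh]
  | succ n ih =>
    rw [pow_succ, ih, pow_succ]
    simp only [mul_assoc, mul_inv_cancel_left₀ hh]

theorem norm_conj {h : ℍ} (hh : h ≠ 0) (q : ℍ) : ‖h⁻¹ * q * h‖ = ‖q‖ := by
  have : ‖h‖ ≠ 0 := norm_ne_zero_iff.2 hh
  rw [norm_mul, norm_mul, norm_inv]
  field_simp

theorem conj_mem_unitBall {h q : ℍ} (hh : h ≠ 0) (hq : q ∈ unitBall) :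
    h⁻¹ * q * h ∈ unitBall := by
  rw [mem_unitBall, norm_conj hh]; exact mem_unitBall.1 hq

/-- `(f * g)(q) = f(q) g(f(q)⁻¹ q f(q))`. -/
theorem seriesEval_mul {p p' : PowerSeries ℍ} (hp : ConvOnBall p) (hp' : ConvOnBall p')
    {q : ℍ} (hq : q ∈ unitBall) (h0 : seriesEval p q ≠ 0) :
    seriesEval (p * p') q =
      seriesEval p q * seriesEval p' ((seriesEval p q)⁻¹ * q * seriesEval p q) := by
  refine (hp.hasSum_mul hp' hq).unique ?_
  refine ((hp'.hasRegSeries _ (conj_mem_unitBall h0 hq)).mul_left (seriesEval p q)).congr_fun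
    fun m => ?_
  rw [conj_pow' _ _ h0]
  simp only [mul_assoc, mul_inv_cancel_left₀ h0]

theorem seriesEval_mul_eq_zero {p p' : PowerSeries ℍ} (hp : ConvOnBall p) (hp' : ConvOnBall p')
    {q : ℍ} (hq : q ∈ unitBall) (h0 : seriesEval p q = 0) : seriesEval (p * p') q = 0 := by
  refine (hp.hasSum_mul hp' hq).unique ?_
  simp [h0, hasSum_zero]

/-- At every point, left multiplication by a regular function evaluates the right factor at a
conjugate of that point, also where the left factor vanishes. -/
theorem exists_seriesEval_mul {p p' : PowerSeries ℍ} (hp : ConvOnBall p) (hp' : ConvOnBall p')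
    {q : ℍ} (hq : q ∈ unitBall) : ∃ h : ℍ, h ≠ 0 ∧
      seriesEval (p * p') q = seriesEval p q * seriesEval p' (h⁻¹ * q * h) := by
  by_cases h0 : seriesEval p q = 0
  · exact ⟨1, one_ne_zero, by rw [seriesEval_mul_eq_zero hp hp' hq h0, h0, zero_mul]⟩
  · exact ⟨_, h0, seriesEval_mul hp hp' hq h0⟩

/-- The regular product is the pointwise one where the first factor commutes with the variable. -/
theorem seriesEval_mul_of_commute {p p' : PowerSeries ℍ} (hp : ConvOnBall p)
    (hp' : ConvOnBall p') {q : ℍ} (hq : q ∈ unitBall) (hc : Commute q (seriesEval p q)) :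
    seriesEval (p * p') q = seriesEval p q * seriesEval p' q := by
  refine (hp.hasSum_mul hp' hq).unique ?_
  refine ((hp'.hasRegSeries _ hq).mul_left (seriesEval p q)).congr_fun fun m => ?_
  rw [(hc.pow_left m).eq, mul_assoc]

theorem seriesEval_add {p p' : PowerSeries ℍ} (hp : ConvOnBall p) (hp' : ConvOnBall p')
    {q : ℍ} (hq : q ∈ unitBall) : seriesEval (p + p') q = seriesEval p q + seriesEval p' q :=
  ((hp.hasRegSeries.add hp'.hasRegSeries).eq_seriesEval hq).symm

theorem seriesEval_sub {p p' : PowerSeries ℍ} (hp : ConvOnBall p) (hp' : ConvOnBall p')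
    {q : ℍ} (hq : q ∈ unitBall) : seriesEval (p - p') q = seriesEval p q - seriesEval p' q :=
  ((hp.hasRegSeries.sub hp'.hasRegSeries).eq_seriesEval hq).symm

theorem seriesEval_mul_C {p : PowerSeries ℍ} (hp : ConvOnBall p) (a : ℍ)
    {q : ℍ} (hq : q ∈ unitBall) : seriesEval (p * C a) q = seriesEval p q * a :=
  ((hp.hasRegSeries.mul_C a).eq_seriesEval hq).symm

theorem seriesEval_C (a : ℍ) {q : ℍ} (hq : q ∈ unitBall) : seriesEval (C a) q = a :=
  ((hasRegSeries_C a).eq_seriesEval hq).symm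

theorem seriesEval_one {q : ℍ} (hq : q ∈ unitBall) : seriesEval 1 q = 1 := seriesEval_C 1 hq

theorem seriesEval_X {q : ℍ} (hq : q ∈ unitBall) : seriesEval X q = q :=
  (hasRegSeries_X.eq_seriesEval hq).symm

theorem IsRealSeries.seriesEval_commute {p : PowerSeries ℍ} (h : IsRealSeries p)
    (hp : ConvOnBall p) {q : ℍ} (hq : q ∈ unitBall) : Commute q (seriesEval p q) := by
  refine ((hp.hasRegSeries q hq).mul_left q).unique ?_
  refine ((hp.hasRegSeries q hq).mul_right q).congr_fun fun n => ?_
  rw [h.coeff_eq, mul_assoc, (Quaternion.coe_commutes _ _), ← mul_assoc, ← mul_assoc,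
    ← pow_succ, ← pow_succ']

theorem IsRealSeries.seriesEval_mul {p p' : PowerSeries ℍ} (h : IsRealSeries p)
    (hp : ConvOnBall p) (hp' : ConvOnBall p') {q : ℍ} (hq : q ∈ unitBall) :
    seriesEval (p * p') q = seriesEval p q * seriesEval p' q :=
  seriesEval_mul_of_commute hp hp' hq (h.seriesEval_commute hp hq)

theorem IsRealSeries.seriesEval_conj {p : PowerSeries ℍ} (h : IsRealSeries p)
    (hp : ConvOnBall p) {q : ℍ} (hq : q ∈ unitBall) {c : ℍ} (hc : c ≠ 0) :
    seriesEval p (c⁻¹ * q * c) = c⁻¹ * seriesEval p q * c := by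
  refine (hp.hasRegSeries _ (conj_mem_unitBall hc hq)).unique ?_
  refine (((hp.hasRegSeries q hq).mul_left c⁻¹).mul_right c).congr_fun fun n => ?_
  rw [h.coeff_eq, conj_pow' _ _ hc]
  simp only [mul_assoc, Quaternion.coe_commutes]

theorem IsRealSeries.norm_seriesEval_conj {p : PowerSeries ℍ} (h : IsRealSeries p)
    (hp : ConvOnBall p) {q : ℍ} (hq : q ∈ unitBall) {c : ℍ} (hc : c ≠ 0) :
    ‖seriesEval p (c⁻¹ * q * c)‖ = ‖seriesEval p q‖ := by
  rw [h.seriesEval_conj hp hq hc, norm_conj hc]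

theorem star_mem_unitBall {q : ℍ} (hq : q ∈ unitBall) : star q ∈ unitBall := by
  rw [mem_unitBall, norm_star]; exact mem_unitBall.1 hq

theorem IsRealSeries.seriesEval_star {p : PowerSeries ℍ} (h : IsRealSeries p)
    (hp : ConvOnBall p) {q : ℍ} (hq : q ∈ unitBall) :
    seriesEval p (star q) = star (seriesEval p q) := by
  refine (hp.hasRegSeries _ (star_mem_unitBall hq)).unique ?_
  refine (hp.hasRegSeries q hq).star.congr_fun fun n => ?_
  rw [h.coeff_eq, star_mul, star_pow, Quaternion.star_coe, Quaternion.coe_commutes]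

/-- The powers of all points of a sphere `x + 𝕊 y` are the same real affine functions of the
point. -/
theorem exists_pow_eq (q : ℍ) (n : ℕ) : ∃ s t : ℝ, ∀ p : ℍ, p.re = q.re → ‖p‖ = ‖q‖ →
    p ^ n = s + t * p := by
  induction n with
  | zero => exact ⟨1, 0, fun p _ _ => by simp⟩
  | succ n ih =>
    obtain ⟨s, t, h⟩ := ih
    refine ⟨-(t * ‖q‖ ^ 2), s + t * (2 * q.re), fun p h1 h2 => ?_⟩
    have hsq : p * p = (2 * q.re : ℝ) * p - ((‖q‖ ^ 2 : ℝ) : ℍ) := by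
      rw [← h1, ← h2, pow_two, ← Quaternion.normSq_eq_norm_mul_self, ← Quaternion.star_mul_self,
        ← Quaternion.self_add_star', add_mul, add_sub_cancel_right]
    rw [pow_succ, h p h1 h2, add_mul, mul_assoc, hsq]
    push_cast
    noncomm_ring

/-- If a regular function has no zero on the ball, neither has its symmetrization. -/
theorem seriesEval_symm_ne_zero {p : PowerSeries ℍ} (hp : ConvOnBall p)
    (h : ∀ q ∈ unitBall, seriesEval p q ≠ 0) {q : ℍ} (hq : q ∈ unitBall) :
    seriesEval (p * conjSeries p) q ≠ 0 := by
  rw [seriesEval_mul hp hp.conjSeries hq (h q hq)]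
  refine mul_ne_zero (h q hq) fun h0 => ?_
  set w := (seriesEval p q)⁻¹ * q * seriesEval p q with hw
  have hwb : w ∈ unitBall := conj_mem_unitBall (h q hq) hq
  clear_value w
  have hwb' := star_mem_unitBall hwb
  -- conjugating `∑ wⁿ (conj aₙ) = 0` puts the powers on the right of the coefficients
  have hz : HasSum (fun n => coeff n p * star w ^ n) 0 := by
    have := (hp.conjSeries.hasRegSeries w hwb).star
    simpa [h0] using this
  by_cases hr : star w = w
  · refine h w hwb ((hp.hasRegSeries w hwb).unique ?_)
    convert hz using 2 with n
    rw [hr, Quaternion.star_eq_self.1 hr, ← Quaternion.coe_pow, Quaternion.coe_commutes]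
  choose s t hst using exists_pow_eq w
  have hst1 : ∀ n, w ^ n = s n + t n * w := fun n => hst n w rfl rfl
  have hst2 : ∀ n, star w ^ n = s n + t n * star w := fun n =>
    hst n _ (by simp) (norm_star w)
  have hd : w - star w ≠ 0 := fun h => hr (sub_eq_zero.1 h).symm
  have hw1 := hp.hasRegSeries w hwb
  obtain ⟨β, hβ⟩ : ∃ β, HasSum (fun n => (t n : ℍ) * coeff n p) β := by
    refine ⟨_, ((hw1.sub (hp.hasRegSeries _ hwb')).mul_left (w - star w)⁻¹).congr_fun ?_⟩
    intro n
    rw [hst1, hst2, ← sub_mul, add_sub_add_left_eq_sub, ← mul_sub,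
      Quaternion.coe_commutes (t n) (w - star w), mul_assoc, inv_mul_cancel_left₀ hd]
  obtain ⟨α, hα⟩ : ∃ α, HasSum (fun n => (s n : ℍ) * coeff n p) α := by
    refine ⟨_, (hw1.sub (hβ.mul_left w)).congr_fun ?_⟩
    intro n
    rw [hst1, add_mul, Quaternion.coe_commutes (t n) w, mul_assoc, add_sub_cancel_right]
  have hαβ : α + β * star w = 0 := by
    refine (hα.add (hβ.mul_right (star w))).unique (hz.congr_fun fun n => ?_)
    rw [hst2, mul_add, ← Quaternion.coe_commutes, ← mul_assoc, ← Quaternion.coe_commutes]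
  have hv : ∀ v ∈ unitBall, v.re = w.re → ‖v‖ = ‖w‖ → seriesEval p v = α + v * β := by
    intro v hvb h1 h2
    refine (hp.hasRegSeries v hvb).unique ((hα.add (hβ.mul_left v)).congr_fun fun n => ?_)
    rw [hst n v h1 h2, add_mul, Quaternion.coe_commutes (t n) v, mul_assoc]
  by_cases hβ0 : β = 0
  · refine h w hwb ?_
    rw [hv w hwb rfl rfl]
    simpa [hβ0] using hαβ
  -- the zero of the function on the sphere of `w`
  · have hre : (β * star w * β⁻¹).re = w.re := by
      have : ∀ x y : ℍ, (x * y).re = (y * x).re := fun x y => by simp; ring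
      rw [this, inv_mul_cancel_left₀ hβ0, Quaternion.re_star]
    have hn : ‖β * star w * β⁻¹‖ = ‖w‖ := by
      simpa using norm_conj (inv_ne_zero hβ0) (star w)
    refine h (β * star w * β⁻¹) (mem_unitBall.2 (hn ▸ mem_unitBall.1 hwb)) ?_
    rw [hv _ (mem_unitBall.2 (hn ▸ mem_unitBall.1 hwb)) hre hn, inv_mul_cancel_right₀ hβ0, hαβ]

/-- If the symmetrization of a regular function has no zero at a point, neither has the function. -/
theorem seriesEval_ne_zero_of_symm {p p' : PowerSeries ℍ} (hp : ConvOnBall p)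
    (hp' : ConvOnBall p') {q : ℍ} (hq : q ∈ unitBall) (h : seriesEval (p * p') q ≠ 0) :
    seriesEval p q ≠ 0 := fun h0 => h (seriesEval_mul_eq_zero hp hp' hq h0)

/-! ### Slices as complex normed spaces -/

/-- The embedding `x + i y ↦ x + I y` of the complex numbers onto the slice of `I`. -/
def sliceHom (I : imagUnits) : ℂ →ₐ[ℝ] ℍ := Complex.lift ⟨I.1, I.2⟩

theorem sliceHom_apply (I : imagUnits) (z : ℂ) : sliceHom I z = (z.re : ℍ) + z.im • (I : ℍ) :=
  Complex.liftAux_apply I.1 I.2 z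

theorem sliceHom_ofReal (I : imagUnits) (x : ℝ) : sliceHom I x = (x : ℍ) := by
  simp

theorem sliceMap_eq (I : imagUnits) (p : ℝ × ℝ) :
    sliceMap I p = sliceHom I (Complex.equivRealProdCLM.symm p) := by
  rw [sliceHom_apply, sliceMap, Quaternion.mul_coe_eq_smul]
  simp

theorem norm_imagUnit (I : imagUnits) : ‖(I : ℍ)‖ = 1 := by
  have h : ‖(I : ℍ) * I‖ = 1 := by rw [show (I : ℍ) * I = -1 from I.2]; simp
  rw [norm_mul] at h
  nlinarith [norm_nonneg (I : ℍ)]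

theorem re_imagUnit (I : imagUnits) : (I : ℍ).re = 0 := by
  refine Quaternion.sq_eq_neg_normSq.1 ?_
  rw [Quaternion.normSq_eq_norm_mul_self, norm_imagUnit, pow_two, show (I : ℍ) * I = -1 from I.2]
  simp

theorem norm_sliceHom (I : imagUnits) (z : ℂ) : ‖sliceHom I z‖ = ‖z‖ := by
  have h1 : ‖sliceHom I z‖ ^ 2 = z.re ^ 2 + z.im ^ 2 := by
    rw [pow_two, ← Quaternion.normSq_eq_norm_mul_self, sliceHom_apply, Quaternion.normSq_add,
      Quaternion.normSq_coe, Quaternion.normSq_smul, Quaternion.normSq_eq_norm_mul_self,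
      norm_imagUnit]
    simp [re_imagUnit]
  have h2 : ‖z‖ ^ 2 = z.re ^ 2 + z.im ^ 2 := by
    rw [← Complex.normSq_eq_norm_sq, Complex.normSq_apply]; ring
  exact (pow_left_inj₀ (norm_nonneg _) (norm_nonneg _) two_ne_zero).1 (h1.trans h2.symm)

/-- The quaternions as a complex vector space, with `i` acting by left multiplication by `I`. -/
def SliceSpace (_ : imagUnits) : Type := ℍ

namespace SliceSpace

variable (I : imagUnits)

instance : NormedAddCommGroup (SliceSpace I) := inferInstanceAs (NormedAddCommGroup ℍ)

instance : CompleteSpace (SliceSpace I) := inferInstanceAs (CompleteSpace ℍ)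

instance : Module ℂ (SliceSpace I) := Module.compHom ℍ (sliceHom I).toRingHom

variable {I}

/-- A quaternion as an element of the slice space. -/
def of (q : ℍ) : SliceSpace I := q

/-- An element of the slice space as a quaternion. -/
def val (q : SliceSpace I) : ℍ := q


theorem norm_of (q : ℍ) : ‖(of q : SliceSpace I)‖ = ‖q‖ := rfl

theorem smul_of (z : ℂ) (q : ℍ) : z • (of q : SliceSpace I) = of (sliceHom I z * q) := rfl

instance : NormedSpace ℂ (SliceSpace I) where
  norm_smul_le z q := by
    change ‖sliceHom I z * val q‖ ≤ ‖z‖ * ‖val q‖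
    rw [norm_mul, norm_sliceHom]

instance : StrictConvexSpace ℝ (SliceSpace I) := by
  refine StrictConvexSpace.of_norm_add_ne_two fun x y hx hy hxy h => hxy ?_
  have := parallelogram_law_with_norm ℝ (val x) (val y)
  change ‖val x‖ = 1 at hx
  change ‖val y‖ = 1 at hy
  change ‖val x + val y‖ = 2 at h
  rw [hx, hy, h] at this
  have h0 : ‖val x - val y‖ = 0 := by nlinarith
  exact sub_eq_zero.1 (norm_eq_zero.1 h0)

theorem hasSum_of_iff {f : ℕ → ℍ} {a : ℍ} :
    HasSum (fun n => (of (f n) : SliceSpace I)) (of a) ↔ HasSum f a := Iff.rfl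

/-- Complex differentiability on a slice is real differentiability with a derivative that
commutes with `I`. -/
theorem hasDerivAt_iff {F : ℂ → ℍ} {c : ℍ} {z : ℂ} {L : ℂ →L[ℝ] ℍ}
    (hL : ∀ w, L w = sliceHom I w * c) :
    HasDerivAt (fun w => (of (F w) : SliceSpace I)) (of c) z ↔ HasFDerivAt F L z := by
  rw [hasDerivAt_iff_hasFDerivAt]
  constructor <;> intro h
  · refine HasFDerivAt.of_isLittleO (h.isLittleO.congr_left fun w => ?_)
    rw [hL]; rfl
  · refine HasFDerivAt.of_isLittleO (h.isLittleO.congr_left fun w => ?_)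
    rw [hL]; rfl

end SliceSpace

open SliceSpace

/-- The real-linear map `z ↦ z c` on the slice of `I`. -/
def sliceMulCLM (I : imagUnits) (c : ℍ) : ℂ →L[ℝ] ℍ :=
  LinearMap.toContinuousLinearMap ((LinearMap.mulRight ℝ c).comp (sliceHom I).toLinearMap)

theorem sliceMulCLM_apply (I : imagUnits) (c : ℍ) (w : ℂ) :
    sliceMulCLM I c w = sliceHom I w * c := rfl

theorem equivRealProdCLM_symm_mk (x y : ℝ) :
    Complex.equivRealProdCLM.symm (x, y) = (⟨x, y⟩ : ℂ) := rfl

theorem sliceHom_I (I : imagUnits) : sliceHom I ⟨0, 1⟩ = I := by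
  simp [sliceHom_apply]

theorem sliceHom_mk_one_zero (I : imagUnits) : sliceHom I ⟨1, 0⟩ = 1 := by
  simp [sliceHom_apply]

/-- The partial derivatives of a function with a complex derivative on a slice. -/
theorem hasFDerivAt_sliceMap {f : ℍ → ℍ} {I : imagUnits} {p : ℝ × ℝ} {c : ℍ}
    (h : HasDerivAt (fun w => (of (f (sliceHom I w)) : SliceSpace I)) (of c)
      (Complex.equivRealProdCLM.symm p)) :
    HasFDerivAt (fun r : ℝ × ℝ => f (sliceMap I r))
      ((sliceMulCLM I c).comp (Complex.equivRealProdCLM.symm : ℝ × ℝ →L[ℝ] ℂ)) p := by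
  have h1 := (SliceSpace.hasDerivAt_iff (sliceMulCLM_apply I c)).1 h
  have h2 := h1.comp p (Complex.equivRealProdCLM.symm : ℝ × ℝ →L[ℝ] ℂ).hasFDerivAt
  simpa only [sliceMap_eq] using! h2

theorem sliceDx_eq {f : ℍ → ℍ} {I : imagUnits} {p : ℝ × ℝ} {c : ℍ}
    (h : HasDerivAt (fun w => (of (f (sliceHom I w)) : SliceSpace I)) (of c)
      (Complex.equivRealProdCLM.symm p)) : sliceDx f I p = c := by
  rw [sliceDx, (hasFDerivAt_sliceMap h).fderiv]
  simp [sliceMulCLM_apply, equivRealProdCLM_symm_mk, sliceHom_mk_one_zero]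

theorem sliceDy_eq {f : ℍ → ℍ} {I : imagUnits} {p : ℝ × ℝ} {c : ℍ}
    (h : HasDerivAt (fun w => (of (f (sliceHom I w)) : SliceSpace I)) (of c)
      (Complex.equivRealProdCLM.symm p)) : sliceDy f I p = I * c := by
  rw [sliceDy, (hasFDerivAt_sliceMap h).fderiv]
  simp [sliceMulCLM_apply, equivRealProdCLM_symm_mk, sliceHom_I]

/-! ### Power series on slices -/

theorem sliceHom_mem_unitBall {I : imagUnits} {z : ℂ} :
    sliceHom I z ∈ unitBall ↔ z ∈ ball (0 : ℂ) 1 := by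
  rw [mem_unitBall, norm_sliceHom, mem_ball_zero_iff]

section
variable {E : Type*} [NormedAddCommGroup E] [NormedSpace ℂ E] [CompleteSpace E]

/-- A power series that converges absolutely on the unit disc is differentiable there, and its
derivative is given by the differentiated series. -/
theorem differentiableAt_tsum_pow_smul {a : ℕ → E}
    (ha : ∀ r : ℝ, 0 ≤ r → r < 1 → Summable fun n => r ^ n * ‖a n‖) {z : ℂ}
    (hz : z ∈ ball (0 : ℂ) 1) :
    DifferentiableAt ℂ (fun w : ℂ => ∑' n, w ^ n • a n) z ∧
      HasSum (fun n : ℕ => z ^ n • ((n : ℂ) + 1) • a (n + 1))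
        (deriv (fun w : ℂ => ∑' n, w ^ n • a n) z) := by
  obtain ⟨r, hzr, hr⟩ := exists_between (mem_ball_zero_iff.1 hz)
  have hzU : z ∈ ball (0 : ℂ) r := mem_ball_zero_iff.2 hzr
  have hF : ∀ n, DifferentiableOn ℂ (fun w : ℂ => w ^ n • a n) (ball 0 r) := fun n =>
    (by fun_prop : Differentiable ℂ fun w : ℂ => w ^ n • a n).differentiableOn
  have hle : ∀ (n : ℕ) (w : ℂ), w ∈ ball (0 : ℂ) r → ‖w ^ n • a n‖ ≤ r ^ n * ‖a n‖ := by
    intro n w hw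
    rw [norm_smul, norm_pow]
    gcongr
    exact (mem_ball_zero_iff.1 hw).le
  have hs := ha r ((norm_nonneg z).trans hzr.le) hr
  refine ⟨(Complex.differentiableOn_tsum_of_summable_norm hs hF isOpen_ball hle).differentiableAt
    (isOpen_ball.mem_nhds hzU), ?_⟩
  have h := Complex.hasSum_deriv_of_summable_norm hs hF isOpen_ball hle hzU
  have hd : ∀ n : ℕ, deriv (fun w : ℂ => w ^ n • a n) z = ((n : ℂ) * z ^ (n - 1)) • a n := fun n =>
    ((hasDerivAt_pow n z).smul_const (a n)).deriv
  simp only [hd] at h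
  have h' := (hasSum_nat_add_iff' 1).2 h
  simp only [Finset.range_one, Finset.sum_singleton, Nat.cast_zero, zero_mul, zero_smul, sub_zero]
    at h'
  refine h'.congr_fun fun n => ?_
  rw [smul_smul]
  congr 1
  push_cast
  simp [mul_comm]

end

/-- The series `∑ qⁿ (n + 1) aₙ₊₁`. -/
def seriesDeriv (p : PowerSeries ℍ) : PowerSeries ℍ :=
  PowerSeries.mk fun n => ((n : ℝ) + 1) • coeff (n + 1) p

@[simp] theorem coeff_seriesDeriv (p : PowerSeries ℍ) (n : ℕ) :
    coeff n (seriesDeriv p) = ((n : ℝ) + 1) • coeff (n + 1) p := by simp [seriesDeriv]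

theorem HasRegSeries.hasSum_slice {f : ℍ → ℍ} {p : PowerSeries ℍ} (h : HasRegSeries f p)
    {I : imagUnits} {z : ℂ} (hz : z ∈ ball (0 : ℂ) 1) :
    HasSum (fun n => z ^ n • (of (coeff n p) : SliceSpace I)) (of (f (sliceHom I z))) := by
  have := hasSum_of_iff (I := I).2 (h _ (sliceHom_mem_unitBall (I := I).2 hz))
  simpa only [smul_of, map_pow] using this

theorem HasRegSeries.hasDerivAt_slice {f : ℍ → ℍ} {p : PowerSeries ℍ} (h : HasRegSeries f p)
    (I : imagUnits) {z : ℂ} (hz : z ∈ ball (0 : ℂ) 1) : ∃ c : ℍ,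
    HasDerivAt (fun w => (of (f (sliceHom I w)) : SliceSpace I)) (of c) z ∧
      HasSum (fun n => sliceHom I z ^ n * coeff n (seriesDeriv p)) c := by
  obtain ⟨h1, h2⟩ := differentiableAt_tsum_pow_smul
    (a := fun n => (of (coeff n p) : SliceSpace I)) h.convOnBall hz
  set c := deriv (fun w : ℂ => ∑' n, w ^ n • (of (coeff n p) : SliceSpace I)) z
  refine ⟨val c, ?_, ?_⟩
  · refine h1.hasDerivAt.congr_of_eventuallyEq ?_
    filter_upwards [isOpen_ball.mem_nhds hz] with w hw
    exact (h.hasSum_slice hw).tsum_eq.symm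
  · refine HasSum.congr_fun (hasSum_of_iff (I := I).1 h2) fun n => ?_
    have : ((n : ℂ) + 1) = (((n : ℝ) + 1 : ℝ) : ℂ) := by push_cast; rfl
    rw [coeff_seriesDeriv, this]
    change _ = sliceHom I (z ^ n) * (sliceHom I ((n + 1 : ℝ) : ℂ) * coeff (n + 1) p)
    rw [sliceHom_ofReal, map_pow, Quaternion.coe_mul_eq_smul]

theorem HasRegSeries.sliceRegularOn {f : ℍ → ℍ} {p : PowerSeries ℍ} (h : HasRegSeries f p) :
    SliceRegularOn f unitBall := by
  intro I hI r hr
  have hz : Complex.equivRealProdCLM.symm r ∈ ball (0 : ℂ) 1 := by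
    rw [← sliceHom_mem_unitBall (I := ⟨I, hI⟩), ← sliceMap_eq]; exact hr
  obtain ⟨c, hc, -⟩ := h.hasDerivAt_slice ⟨I, hI⟩ hz
  refine ⟨(hasFDerivAt_sliceMap hc).differentiableAt, ?_⟩
  rw [sliceDx_eq (I := ⟨I, hI⟩) hc, sliceDy_eq (I := ⟨I, hI⟩) hc, ← mul_assoc,
    show I * I = -1 from hI]
  simp

theorem sliceUnit_of_im_eq_zero {q : ℍ} (h : q.im = 0) : sliceUnit q = ⟨0, 1, 0, 0⟩ := if_pos h

theorem sliceUnit_of_im_ne_zero {q : ℍ} (h : q.im ≠ 0) : sliceUnit q = (‖q.im‖⁻¹ : ℝ) • q.im :=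
  if_neg h

theorem sliceUnit_mem (q : ℍ) : sliceUnit q ∈ imagUnits := by
  change _ * _ = _
  by_cases h : q.im = 0
  · have hi : ∀ a : ℍ, a.re = 0 → a.imI = 1 → a.imJ = 0 → a.imK = 0 → a * a = -1 := by
      intro a h1 h2 h3 h4
      ext <;> simp [h1, h2, h3, h4, Quaternion.re_one, Quaternion.imI_one, Quaternion.imJ_one,
        Quaternion.imK_one]
    rw [sliceUnit_of_im_eq_zero h]
    exact hi _ rfl rfl rfl rfl
  · have hn : ‖q.im‖ ≠ 0 := norm_ne_zero_iff.2 h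
    have h2 : q.im * q.im = -((‖q.im‖ * ‖q.im‖ : ℝ) : ℍ) := by
      rw [← pow_two, Quaternion.im_sq, Quaternion.normSq_eq_norm_mul_self]
    rw [sliceUnit_of_im_ne_zero h, smul_mul_smul_comm, h2, smul_neg,
      ← Quaternion.coe_mul_eq_smul, ← Quaternion.coe_mul,
      show ‖q.im‖⁻¹ * ‖q.im‖⁻¹ * (‖q.im‖ * ‖q.im‖) = 1 by field_simp, Quaternion.coe_one]

theorem sliceHom_sliceUnit (q : ℍ) :
    sliceHom ⟨sliceUnit q, sliceUnit_mem q⟩ ⟨q.re, ‖q.im‖⟩ = q := by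
  rw [sliceHom_apply]
  by_cases h : q.im = 0
  · conv_rhs => rw [← Quaternion.re_add_im q, h]
    rw [h, norm_zero, zero_smul]
  · simp only [sliceUnit_of_im_ne_zero h]
    rw [smul_smul, mul_inv_cancel₀ (norm_ne_zero_iff.2 h), one_smul, Quaternion.re_add_im]

/-- The Cullen derivative of `∑ qⁿ aₙ` is `∑ qⁿ (n + 1) aₙ₊₁`. -/
theorem HasRegSeries.cullenDeriv {f : ℍ → ℍ} {p : PowerSeries ℍ} (h : HasRegSeries f p) :
    HasRegSeries (cullenDeriv f) (seriesDeriv p) := by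
  intro q hq
  have hz : (⟨q.re, ‖q.im‖⟩ : ℂ) ∈ ball (0 : ℂ) 1 := by
    rw [← sliceHom_mem_unitBall (I := ⟨sliceUnit q, sliceUnit_mem q⟩), sliceHom_sliceUnit]
    exact hq
  obtain ⟨c, hc, hs⟩ := h.hasDerivAt_slice ⟨sliceUnit q, sliceUnit_mem q⟩ hz
  rw [sliceHom_sliceUnit] at hs
  have hI : sliceUnit q * sliceUnit q = -1 := sliceUnit_mem q
  convert hs
  rw [_root_.cullenDeriv, sliceDx_eq (I := ⟨sliceUnit q, sliceUnit_mem q⟩) hc,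
    sliceDy_eq (I := ⟨sliceUnit q, sliceUnit_mem q⟩) hc, ← mul_assoc, hI, neg_one_mul,
    sub_neg_eq_add, ← two_smul ℝ c, smul_smul]
  norm_num

/-- A power series is determined by its values on the real diameter. -/
theorem eq_of_hasSum_real {F : ℝ → ℍ} {p p' : PowerSeries ℍ}
    (h : ∀ x : ℝ, |x| < 1 → HasSum (fun n => (x : ℍ) ^ n * coeff n p) (F x))
    (h' : ∀ x : ℝ, |x| < 1 → HasSum (fun n => (x : ℍ) ^ n * coeff n p') (F x)) : p = p' := by
  let S : PowerSeries ℍ → FormalMultilinearSeries ℝ ℝ ℍ := fun r n =>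
    ContinuousMultilinearMap.mkPiRing ℝ (Fin n) (PowerSeries.coeff n r)
  have hS : ∀ r n, (S r).coeff n = PowerSeries.coeff n r := by
    intro r n
    simp [S, FormalMultilinearSeries.coeff]
  have key : ∀ r : PowerSeries ℍ,
      (∀ x : ℝ, |x| < 1 → HasSum (fun n => (x : ℍ) ^ n * coeff n r) (F x)) →
      HasFPowerSeriesAt F (S r) 0 := by
    intro r hr
    refine hasFPowerSeriesAt_iff.2 ?_
    filter_upwards [ball_mem_nhds (0 : ℝ) one_pos] with x hx
    have := hr x (by simpa using hx)
    simpa [hS, ← Quaternion.coe_pow, Quaternion.coe_mul_eq_smul] using this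
  have e := (key p h).eq_formalMultilinearSeries (key p' h')
  ext1 n
  rw [← hS p n, ← hS p' n, e]

/-- A slice regular function on the ball is the sum of a power series: on each slice it is a
holomorphic function, and the Taylor coefficients on all slices agree because the slices share
the real diameter. -/
theorem SliceRegularOn.exists_hasRegSeries {f : ℍ → ℍ} (hf : SliceRegularOn f unitBall) :
    ∃ p, HasRegSeries f p := by
  have hd : ∀ I : imagUnits, DifferentiableOn ℂ
      (fun w => (of (f (sliceHom I w)) : SliceSpace I)) (ball 0 1) := by
    intro I z hz
    set r := Complex.equivRealProdCLM z
    have hzr : Complex.equivRealProdCLM.symm r = z :=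
      Complex.equivRealProdCLM.symm_apply_apply z
    obtain ⟨h1, h2⟩ := hf I I.2 r (by
      rw [sliceMap_eq, hzr]; exact sliceHom_mem_unitBall.2 hz)
    have h3 : HasFDerivAt (fun w => f (sliceHom I w))
        ((fderiv ℝ (fun r => f (sliceMap I r)) r).comp
          (Complex.equivRealProdCLM : ℂ →L[ℝ] ℝ × ℝ)) z := by
      have := h1.hasFDerivAt.comp z (Complex.equivRealProdCLM : ℂ →L[ℝ] ℝ × ℝ).hasFDerivAt
      refine this.congr_of_eventuallyEq (Filter.Eventually.of_forall fun w => ?_)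
      rw [Function.comp_apply, sliceMap_eq]
      exact congrArg (fun z => f (sliceHom I z))
        (Complex.equivRealProdCLM.symm_apply_apply w).symm
    refine DifferentiableAt.differentiableWithinAt ?_
    refine ((SliceSpace.hasDerivAt_iff (c := sliceDx f I r) fun w => ?_).2 h3).differentiableAt
    have h4 : sliceDx f I r = -(I * sliceDy f I r) :=
      eq_neg_of_add_eq_zero_left ((smul_eq_zero.1 h2).resolve_left (by norm_num))
    have h5 : sliceDy f I r = I * sliceDx f I r := by
      rw [h4, mul_neg, ← mul_assoc, show (I : ℍ) * I = -1 from I.2]; simp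
    have h6 : Complex.equivRealProdCLM w = w.re • ((1, 0) : ℝ × ℝ) + w.im • ((0, 1) : ℝ × ℝ) := by
      ext <;> simp
    rw [ContinuousLinearMap.comp_apply, ContinuousLinearEquiv.coe_coe, h6, map_add, map_smul,
      map_smul]
    change w.re • sliceDx f I r + w.im • sliceDy f I r = _
    rw [h5, sliceHom_apply, add_mul, Quaternion.coe_mul_eq_smul, smul_mul_assoc]
  let P : imagUnits → PowerSeries ℍ := fun I => PowerSeries.mk fun n =>
    val ((n.factorial : ℂ)⁻¹ • iteratedDeriv n
      (fun w => (of (f (sliceHom I w)) : SliceSpace I)) 0)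
  have hP : ∀ (I : imagUnits) (z : ℂ), z ∈ ball (0 : ℂ) 1 →
      HasSum (fun n => sliceHom I z ^ n * coeff n (P I)) (f (sliceHom I z)) := by
    intro I z hz
    refine HasSum.congr_fun
      (hasSum_of_iff (I := I).1 (Complex.hasSum_taylorSeries_on_ball (hd I) hz)) fun n => ?_
    rw [sub_zero, smul_comm, coeff_mk, ← map_pow]
    rfl
  have hPI : ∀ I J, P I = P J := by
    intro I J
    refine eq_of_hasSum_real (F := fun x => f x) (fun x hx => ?_) fun x hx => ?_
    · simpa only [sliceHom_ofReal] using hP I x (by simpa using hx)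
    · simpa only [sliceHom_ofReal] using hP J x (by simpa using hx)
  refine ⟨P ⟨sliceUnit 0, sliceUnit_mem 0⟩, fun q hq => ?_⟩
  rw [hPI _ ⟨sliceUnit q, sliceUnit_mem q⟩]
  have hz : (⟨q.re, ‖q.im‖⟩ : ℂ) ∈ ball (0 : ℂ) 1 := by
    rw [← sliceHom_mem_unitBall (I := ⟨sliceUnit q, sliceUnit_mem q⟩), sliceHom_sliceUnit]
    exact hq
  simpa only [sliceHom_sliceUnit] using hP ⟨sliceUnit q, sliceUnit_mem q⟩ _ hz

/-! ### A maximum principle for quotients of regular functions -/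

/-- A real power series acts on the slice of `I` as a holomorphic function. -/
theorem IsRealSeries.exists_slice {s : PowerSeries ℍ} (hs : IsRealSeries s) (hc : ConvOnBall s) :
    ∃ d : ℂ → ℂ, DifferentiableOn ℂ d (ball 0 1) ∧
      ∀ (I : imagUnits), ∀ z ∈ ball (0 : ℂ) 1, sliceHom I (d z) = seriesEval s (sliceHom I z) := by
  have ha : ∀ r : ℝ, 0 ≤ r → r < 1 → Summable fun n => r ^ n * ‖((coeff n s).re : ℂ)‖ := by
    intro r h0 h1
    refine (hc r h0 h1).congr fun n => ?_
    conv_lhs => rw [hs.coeff_eq]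
    simp
  refine ⟨fun w => ∑' n, w ^ n • ((coeff n s).re : ℂ), fun z hz =>
    (differentiableAt_tsum_pow_smul ha hz).1.differentiableWithinAt, fun I z hz => ?_⟩
  have hsum : Summable fun n => z ^ n • ((coeff n s).re : ℂ) := by
    refine Summable.of_norm ((ha ‖z‖ (norm_nonneg z) (mem_ball_zero_iff.1 hz)).congr fun n => ?_)
    rw [norm_smul, norm_pow]
  have hcont : Continuous (sliceHom I) := (sliceHom I).toLinearMap.continuous_of_finiteDimensional
  refine (hsum.hasSum.map (sliceHom I) hcont).unique ?_
  refine (hc.hasRegSeries _ (sliceHom_mem_unitBall.2 hz)).congr_fun fun n => ?_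
  rw [Function.comp_apply, smul_eq_mul, map_mul, map_pow, sliceHom_ofReal, ← hs.coeff_eq]

/-- Let `s` be a real regular function without zeros. If `|p| ≤ C(|q|) |s|` near the boundary of
the ball, where `C(r) → 1` as `r → 1`, then either `|p| < |s|` on the ball or `p = s u` for a
constant `u` of modulus `1`. This is the maximum modulus principle for `s⁻¹ p` on each slice; the
slices communicate through the real diameter. -/
theorem norm_lt_or_eq_mul_C {p s : PowerSeries ℍ} (hp : ConvOnBall p) (hs : ConvOnBall s)
    (hreal : IsRealSeries s) (hs0 : ∀ q ∈ unitBall, seriesEval s q ≠ 0) {C : ℝ → ℝ}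
    (hC : Filter.Tendsto C (nhdsWithin 1 (Iio 1)) (nhds 1)) {r₀ : ℝ} (hr₀ : r₀ < 1)
    (hb : ∀ q ∈ unitBall, r₀ < ‖q‖ → ‖seriesEval p q‖ ≤ C ‖q‖ * ‖seriesEval s q‖) :
    (∀ q ∈ unitBall, ‖seriesEval p q‖ < ‖seriesEval s q‖) ∨
      ∃ u : ℍ, ‖u‖ = 1 ∧ p = s * PowerSeries.C u := by
  obtain ⟨d, hd, hds⟩ := hreal.exists_slice hs
  let G : (I : imagUnits) → ℂ → SliceSpace I := fun I z =>
    (d z)⁻¹ • of (seriesEval p (sliceHom I z))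
  have hd0 : ∀ z ∈ ball (0 : ℂ) 1, d z ≠ 0 := by
    intro z hz h0
    let I : imagUnits := ⟨sliceUnit 0, sliceUnit_mem 0⟩
    refine hs0 _ (sliceHom_mem_unitBall (I := I).2 hz) ?_
    rw [← hds I z hz, h0, map_zero]
  have hGd : ∀ I, DifferentiableOn ℂ (G I) (ball 0 1) := by
    intro I z hz
    obtain ⟨c, hc, -⟩ := hp.hasRegSeries.hasDerivAt_slice I hz
    exact ((hd z hz).inv (hd0 z hz)).smul hc.differentiableAt.differentiableWithinAt
  have hGn : ∀ I, ∀ z ∈ ball (0 : ℂ) 1,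
      ‖G I z‖ = ‖seriesEval p (sliceHom I z)‖ / ‖seriesEval s (sliceHom I z)‖ := by
    intro I z hz
    rw [norm_smul, norm_of, norm_inv, ← hds I z hz, norm_sliceHom, inv_mul_eq_div]
  have hG1 : ∀ I, ∀ z ∈ ball (0 : ℂ) 1, ‖G I z‖ ≤ 1 := by
    intro I z hz
    refine ge_of_tendsto hC ?_
    have hmem : Ioo (max (max r₀ ‖z‖) 0) 1 ∈ nhdsWithin (1 : ℝ) (Iio 1) :=
      Ioo_mem_nhdsLT (max_lt (max_lt hr₀ (mem_ball_zero_iff.1 hz)) one_pos)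
    filter_upwards [hmem] with r hr
    have hr1 : r₀ < r := lt_of_le_of_lt ((le_max_left _ _).trans (le_max_left _ _)) hr.1
    have hr2 : ‖z‖ < r := lt_of_le_of_lt ((le_max_right _ _).trans (le_max_left _ _)) hr.1
    have hr3 : 0 < r := lt_of_le_of_lt (le_max_right _ _) hr.1
    have hsub : closedBall (0 : ℂ) r ⊆ ball 0 1 := closedBall_subset_ball hr.2
    refine Complex.norm_le_of_forall_mem_frontier_norm_le (U := ball (0 : ℂ) r) isBounded_ball
      ⟨(hGd I).mono (ball_subset_closedBall.trans hsub), ?_⟩ ?_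
      (subset_closure (mem_ball_zero_iff.2 hr2))
    · rw [closure_ball _ hr3.ne']
      exact (hGd I).continuousOn.mono hsub
    · intro w hw
      rw [frontier_ball _ hr3.ne'] at hw
      have hwr : ‖w‖ = r := mem_sphere_zero_iff_norm.1 hw
      have hwb : w ∈ ball (0 : ℂ) 1 := hsub (sphere_subset_closedBall hw)
      have hwq := sliceHom_mem_unitBall (I := I).2 hwb
      rw [hGn I w hwb, div_le_iff₀ (norm_pos_iff.2 (hs0 _ hwq))]
      have := hb _ hwq (by rw [norm_sliceHom, hwr]; exact hr1)
      rwa [norm_sliceHom, hwr] at this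
  have hle : ∀ q ∈ unitBall, ‖seriesEval p q‖ ≤ ‖seriesEval s q‖ := by
    intro q hq
    rw [← sliceHom_sliceUnit q] at hq ⊢
    have hz := sliceHom_mem_unitBall.1 hq
    have := hG1 ⟨sliceUnit q, sliceUnit_mem q⟩ _ hz
    rwa [hGn _ _ hz, div_le_one (norm_pos_iff.2 (hs0 _ hq))] at this
  rw [or_iff_not_imp_left]
  intro hlt
  push Not at hlt
  obtain ⟨q, hq, hqle⟩ := hlt
  -- on a slice where the bound is attained, the quotient is constant
  have hconst : ∀ (I : imagUnits), ∀ z ∈ ball (0 : ℂ) 1, ‖G I z‖ = 1 →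
      ∀ w ∈ ball (0 : ℂ) 1, G I w = G I z := by
    intro I z hz h1
    refine Complex.eqOn_of_isPreconnected_of_isMaxOn_norm (convex_ball _ _).isPreconnected
      isOpen_ball (hGd I) hz fun w hw => ?_
    simpa [h1] using hG1 I w hw
  obtain ⟨I, z, hz, h1⟩ : ∃ (I : imagUnits) (z : ℂ), z ∈ ball (0 : ℂ) 1 ∧ ‖G I z‖ = 1 := by
    rw [← sliceHom_sliceUnit q] at hq hqle
    have hz := sliceHom_mem_unitBall.1 hq
    refine ⟨⟨sliceUnit q, sliceUnit_mem q⟩, _, hz, ?_⟩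
    rw [hGn _ _ hz, div_eq_one_iff_eq (norm_ne_zero_iff.2 (hs0 _ hq))]
    exact le_antisymm (hle _ hq) hqle
  refine ⟨val (G I z), h1, ?_⟩
  refine eq_of_hasSum_real (F := fun x => seriesEval p (x : ℍ)) (fun x hx => ?_) fun x hx => ?_
  · exact hp.hasRegSeries _ (by simpa [mem_unitBall] using hx)
  have hxb : (x : ℂ) ∈ ball (0 : ℂ) 1 := by simpa using hx
  have hxq : (x : ℍ) ∈ unitBall := by simpa [mem_unitBall] using hx
  have := (hs.mul (convOnBall_C (val (G I z)))).hasRegSeries _ hxq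
  rw [seriesEval_mul_C hs _ hxq] at this
  convert this
  have h2 : val (G I z) = sliceHom I (d x)⁻¹ * seriesEval p (sliceHom I x) := by
    rw [← hconst I z hz h1 x hxb]; rfl
  rw [h2, map_inv₀, hds I _ hxb, sliceHom_ofReal, mul_inv_cancel_left₀ (hs0 _ hxq)]

/-! ### Quaternionic Möbius expressions in a regular function -/

/-- The series of `1 - conj(a) * f`. -/
def oneSubLeft (a : ℍ) (p : PowerSeries ℍ) : PowerSeries ℍ := 1 - C (star a) * p

/-- The series of `1 - f conj(a)`. -/
def oneSubRight (a : ℍ) (p : PowerSeries ℍ) : PowerSeries ℍ := 1 - p * C (star a)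

theorem conjSeries_oneSubLeft (a : ℍ) (p : PowerSeries ℍ) :
    conjSeries (oneSubLeft a p) = 1 - conjSeries p * C a := by
  simp [oneSubLeft, conjSeries_sub, conjSeries_mul]

theorem conjSeries_oneSubRight (a : ℍ) (p : PowerSeries ℍ) :
    conjSeries (oneSubRight a p) = 1 - C a * conjSeries p := by
  simp [oneSubRight, conjSeries_sub, conjSeries_mul]

theorem ConvOnBall.oneSubLeft {p : PowerSeries ℍ} (hp : ConvOnBall p) (a : ℍ) :
    ConvOnBall (oneSubLeft a p) := convOnBall_one.sub ((convOnBall_C _).mul hp)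

theorem ConvOnBall.oneSubRight {p : PowerSeries ℍ} (hp : ConvOnBall p) (a : ℍ) :
    ConvOnBall (oneSubRight a p) := convOnBall_one.sub (hp.mul (convOnBall_C _))

theorem isRealSeries_C_star_mul (a : ℍ) : IsRealSeries (C (star a) * C a) := by
  rw [IsRealSeries, conjSeries_mul, conjSeries_C, conjSeries_C, star_star]

/-- The symmetrization of `1 - conj(a) * f`, in expanded form. -/
theorem oneSubLeft_symm (a : ℍ) (p : PowerSeries ℍ) :
    oneSubLeft a p * conjSeries (oneSubLeft a p) =
      1 - (C (star a) * p + conjSeries p * C a) + p * conjSeries p * (C (star a) * C a) := by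
  have h : C (star a) * p * (conjSeries p * C a) = p * conjSeries p * (C (star a) * C a) := by
    rw [← mul_assoc, ← mul_assoc, mul_assoc (C (star a)),
      ← (isRealSeries_mul_conjSeries p).mul_comm]
  rw [conjSeries_oneSubLeft, oneSubLeft, sub_mul, mul_sub, mul_sub, h]
  simp only [one_mul, mul_one]
  abel

/-- The functions `1 - conj(a) * f` and `1 - f conj(a)` have the same symmetrization. -/
theorem oneSubRight_symm (a : ℍ) (p : PowerSeries ℍ) :
    oneSubRight a p * conjSeries (oneSubRight a p) =
      oneSubLeft a p * conjSeries (oneSubLeft a p) := by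
  have h : p * C (star a) * (C a * conjSeries p) = p * conjSeries p * (C (star a) * C a) := by
    rw [mul_assoc, ← mul_assoc (C (star a)), (isRealSeries_C_star_mul a).mul_comm, mul_assoc]
  rw [oneSubLeft_symm, trace_comm, conjSeries_oneSubRight, oneSubRight, sub_mul, mul_sub, mul_sub,
    h]
  simp only [one_mul, mul_one]
  abel

/-- The two quotients `(f - a) * (1 - conj(a) * f)^{-*}` and `(1 - f conj(a))^{-*} * (f - a)`
coincide; in terms of numerators over the common symmetrization: -/
theorem sub_C_mul_conjSeries_oneSubLeft (a : ℍ) (p : PowerSeries ℍ) :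
    (p - C a) * conjSeries (oneSubLeft a p) = conjSeries (oneSubRight a p) * (p - C a) := by
  have h : p * (conjSeries p * C a) = C a * conjSeries p * p := by
    rw [← mul_assoc, mul_assoc (C a), conjSeries_mul_self,
      (isRealSeries_mul_conjSeries p).mul_comm]
  simp only [conjSeries_oneSubLeft, conjSeries_oneSubRight, sub_mul, mul_sub, one_mul, mul_one, h]
  simp only [mul_assoc]
  abel

theorem norm_sq_one_sub_sub (x y : ℍ) :
    ‖1 - x * star y‖ ^ 2 - ‖x - y‖ ^ 2 = (1 - ‖x‖ ^ 2) * (1 - ‖y‖ ^ 2) := by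
  have h : ∀ z : ℍ, ‖z‖ ^ 2 = z.re ^ 2 + z.imI ^ 2 + z.imJ ^ 2 + z.imK ^ 2 := fun z => by
    rw [pow_two, ← Quaternion.normSq_eq_norm_mul_self, Quaternion.normSq_def']
  simp only [h]
  simp [Quaternion.re_one, Quaternion.imI_one, Quaternion.imJ_one, Quaternion.imK_one]
  ring

theorem norm_sub_lt_norm_one_sub {x y : ℍ} (hx : ‖x‖ < 1) (hy : ‖y‖ < 1) :
    ‖x - y‖ < ‖1 - x * star y‖ := by
  refine lt_of_pow_lt_pow_left₀ 2 (norm_nonneg _) (sub_pos.1 ?_)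
  rw [norm_sq_one_sub_sub]
  have h1 : ‖x‖ ^ 2 < 1 := by nlinarith [norm_nonneg x]
  have h2 : ‖y‖ ^ 2 < 1 := by nlinarith [norm_nonneg y]
  exact mul_pos (by linarith) (by linarith)

section
variable {p : PowerSeries ℍ} {a : ℍ}

theorem seriesEval_oneSubRight (hp : ConvOnBall p) {q : ℍ} (hq : q ∈ unitBall) :
    seriesEval (oneSubRight a p) q = 1 - seriesEval p q * star a := by
  rw [oneSubRight, seriesEval_sub convOnBall_one (hp.mul (convOnBall_C _)) hq, seriesEval_one hq,
    seriesEval_mul_C hp _ hq]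

theorem seriesEval_oneSubLeft_ne_zero (hp : ConvOnBall p)
    (hp1 : ∀ q ∈ unitBall, ‖seriesEval p q‖ < 1) (ha : ‖a‖ < 1) {q : ℍ} (hq : q ∈ unitBall) :
    seriesEval (oneSubLeft a p) q ≠ 0 := by
  rw [oneSubLeft, seriesEval_sub convOnBall_one ((convOnBall_C _).mul hp) hq, seriesEval_one hq,
    sub_ne_zero]
  obtain ⟨h, h0, heq⟩ := exists_seriesEval_mul (convOnBall_C (star a)) hp hq
  intro h1
  have h2 : ‖(1 : ℍ)‖ < 1 := by
    rw [h1, heq, seriesEval_C _ hq, norm_mul, norm_star]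
    exact mul_lt_one_of_nonneg_of_lt_one_left (norm_nonneg _) ha
      (hp1 _ (conj_mem_unitBall h0 hq)).le
  simp at h2

/-- The symmetrization of `1 - conj(a) * f` has no zeros on the ball. -/
theorem seriesEval_oneSubLeft_symm_ne_zero (hp : ConvOnBall p)
    (hp1 : ∀ q ∈ unitBall, ‖seriesEval p q‖ < 1) (ha : ‖a‖ < 1) {q : ℍ} (hq : q ∈ unitBall) :
    seriesEval (oneSubLeft a p * conjSeries (oneSubLeft a p)) q ≠ 0 :=
  seriesEval_symm_ne_zero (hp.oneSubLeft a)
    (fun _ h => seriesEval_oneSubLeft_ne_zero hp hp1 ha h) hq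

/-- The function `(f - a) * (1 - conj(a) * f)^{-*}` maps the ball to itself: up to a rotation of
the variable it is the pointwise Möbius transform `(1 - f conj(a))⁻¹ (f - a)`. -/
theorem norm_seriesEval_sub_C_mul_lt (hp : ConvOnBall p)
    (hp1 : ∀ q ∈ unitBall, ‖seriesEval p q‖ < 1) (ha : ‖a‖ < 1) {q : ℍ} (hq : q ∈ unitBall) :
    ‖seriesEval ((p - C a) * conjSeries (oneSubLeft a p)) q‖ <
      ‖seriesEval (oneSubLeft a p * conjSeries (oneSubLeft a p)) q‖ := by
  have hS := seriesEval_oneSubLeft_symm_ne_zero hp hp1 ha hq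
  rw [sub_C_mul_conjSeries_oneSubLeft]
  rw [← oneSubRight_symm, ← conjSeries_mul_self] at hS ⊢
  have hB := hp.oneSubRight a
  have hB0 := seriesEval_ne_zero_of_symm hB.conjSeries hB hq hS
  rw [seriesEval_mul hB.conjSeries (hp.sub (convOnBall_C a)) hq hB0,
    seriesEval_mul hB.conjSeries hB hq hB0, norm_mul, norm_mul]
  have ht := conj_mem_unitBall hB0 hq
  refine mul_lt_mul_of_pos_left ?_ (norm_pos_iff.2 hB0)
  rw [seriesEval_sub hp (convOnBall_C a) ht, seriesEval_oneSubRight hp ht, seriesEval_C _ ht]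
  exact norm_sub_lt_norm_one_sub (hp1 _ ht) ha

end

/-- The factor theorem: a regular function vanishing at `q₀` is divisible by `q - q₀`. -/
theorem ConvOnBall.exists_eq_X_sub_C_mul {p : PowerSeries ℍ} (hp : ConvOnBall p) {q₀ : ℍ}
    (hq₀ : q₀ ∈ unitBall) (h0 : seriesEval p q₀ = 0) :
    ∃ R, ConvOnBall R ∧ p = (X - C q₀) * R := by
  have hsum : ∀ k, Summable fun j => q₀ ^ j * coeff (j + k) p := by
    intro k
    rcases eq_or_ne q₀ 0 with rfl | hne
    · refine summable_of_ne_finset_zero (s := {0}) fun j hj => ?_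
      rw [zero_pow (by simpa using hj), zero_mul]
    · refine (((summable_nat_add_iff k).2 (hp.hasRegSeries q₀ hq₀).summable).mul_left
        (q₀ ^ k)⁻¹).congr fun j => ?_
      rw [add_comm j k, pow_add, mul_assoc, inv_mul_cancel_left₀ (pow_ne_zero _ hne)]
  refine ⟨PowerSeries.mk fun k => ∑' j, q₀ ^ j * coeff (j + (k + 1)) p, ?_, ?_⟩
  · intro r hr0 hr1
    obtain ⟨ρ, hρ, hρ1⟩ := exists_between (max_lt hr1 (mem_unitBall.1 hq₀))
    have hrρ : r < ρ := lt_of_le_of_lt (le_max_left _ _) hρ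
    have hqρ : ‖q₀‖ < ρ := lt_of_le_of_lt (le_max_right _ _) hρ
    have hρ0 : 0 < ρ := lt_of_le_of_lt hr0 hrρ
    obtain ⟨M, hM⟩ := (hp ρ hρ0.le hρ1).tendsto_atTop_zero.bddAbove_range
    have hM' : ∀ n, ‖coeff n p‖ ≤ M / ρ ^ n := fun n => by
      rw [le_div_iff₀ (by positivity), mul_comm]
      exact hM ⟨n, rfl⟩
    have hgeo : HasSum (fun j => (‖q₀‖ / ρ) ^ j) (1 - ‖q₀‖ / ρ)⁻¹ :=
      hasSum_geometric_of_lt_one (by positivity) ((div_lt_one hρ0).2 hqρ)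
    have hR : ∀ k, ‖∑' j, q₀ ^ j * coeff (j + (k + 1)) p‖ ≤
        M / ρ ^ (k + 1) * (1 - ‖q₀‖ / ρ)⁻¹ := by
      intro k
      refine tsum_of_norm_bounded (hgeo.mul_left _) fun j => ?_
      rw [norm_mul, norm_pow]
      calc ‖q₀‖ ^ j * ‖coeff (j + (k + 1)) p‖ ≤ ‖q₀‖ ^ j * (M / ρ ^ (j + (k + 1))) := by
            gcongr; exact hM' _
        _ = M / ρ ^ (k + 1) * (‖q₀‖ / ρ) ^ j := by
            rw [div_pow, pow_add]; field_simp
    refine Summable.of_nonneg_of_le (fun k => by positivity) (fun k => ?_)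
      ((summable_geometric_of_lt_one (div_nonneg hr0 hρ0.le) ((div_lt_one hρ0).2 hrρ)).mul_left
        (M / ρ * (1 - ‖q₀‖ / ρ)⁻¹))
    rw [coeff_mk]
    calc r ^ k * ‖∑' j, q₀ ^ j * coeff (j + (k + 1)) p‖
        ≤ r ^ k * (M / ρ ^ (k + 1) * (1 - ‖q₀‖ / ρ)⁻¹) := by gcongr; exact hR k
      _ = M / ρ * (1 - ‖q₀‖ / ρ)⁻¹ * (r / ρ) ^ k := by
          rw [div_pow, pow_succ]; field_simp
  · ext1 n
    have hstep : ∀ k, ∑' j, q₀ ^ j * coeff (j + k) p =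
        coeff k p + q₀ * ∑' j, q₀ ^ j * coeff (j + (k + 1)) p := by
      intro k
      rw [(hsum k).tsum_eq_zero_add, ← tsum_mul_left]
      simp only [pow_zero, one_mul, zero_add]
      congr 1
      refine tsum_congr fun j => ?_
      rw [pow_succ', mul_assoc, show j + 1 + k = j + (k + 1) by ring]
    cases n with
    | zero =>
      have := hstep 0
      simp only [add_zero] at this
      rw [show ∑' j, q₀ ^ j * coeff j p = 0 from h0] at this
      simp only [sub_mul, map_sub, coeff_zero_X_mul, coeff_C_mul, coeff_mk, zero_sub]
      exact eq_neg_of_add_eq_zero_left this.symm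
    | succ n =>
      simp only [sub_mul, map_sub, coeff_succ_X_mul, coeff_C_mul, coeff_mk]
      rw [hstep (n + 1), add_sub_cancel_right]

theorem convOnBall_X_sub_C (b : ℍ) : ConvOnBall (X - C b) := convOnBall_X.sub (convOnBall_C b)

theorem seriesEval_X_sub_C (b : ℍ) {q : ℍ} (hq : q ∈ unitBall) :
    seriesEval (X - C b) q = q - b := by
  rw [seriesEval_sub convOnBall_X (convOnBall_C b) hq, seriesEval_X hq, seriesEval_C b hq]

theorem seriesEval_oneSubRight_X (b : ℍ) {q : ℍ} (hq : q ∈ unitBall) :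
    seriesEval (oneSubRight b X) q = 1 - q * star b := by
  rw [seriesEval_oneSubRight convOnBall_X hq, seriesEval_X hq]

theorem oneSubLeft_X (b : ℍ) : oneSubLeft b X = oneSubRight b X := by
  rw [oneSubLeft, oneSubRight, (commute_X (C (star b))).eq]

/-- The Schwarz-Pick dichotomy. Write `a = f(q₀)` and `f - a = (q - q₀) * R`. Then the regular
function `(1 - q conj(q₀)) * R * (1 - conj(a) * f)^{-*}`, which is the quotient of the Möbius
transform of `f` by the one of the variable, either has modulus less than `1` on the ball or is a
constant of modulus `1`. -/
theorem schwarzPick_dichotomy {p R : PowerSeries ℍ} {a q₀ : ℍ} (hp : ConvOnBall p)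
    (hp1 : ∀ q ∈ unitBall, ‖seriesEval p q‖ < 1) (ha : ‖a‖ < 1) (hq₀ : q₀ ∈ unitBall)
    (hR : ConvOnBall R) (hpR : p - C a = (X - C q₀) * R) :
    (∀ q ∈ unitBall,
      ‖seriesEval (oneSubRight q₀ X * R * conjSeries (oneSubLeft a p)) q‖ <
        ‖seriesEval (oneSubLeft a p * conjSeries (oneSubLeft a p)) q‖) ∨
    ∃ u : ℍ, ‖u‖ = 1 ∧ oneSubRight q₀ X * R * conjSeries (oneSubLeft a p) =
      oneSubLeft a p * conjSeries (oneSubLeft a p) * C u := by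
  set E := oneSubRight q₀ X with hE
  set D := oneSubLeft a p
  set N := E * R * conjSeries D
  set V := (p - C a) * conjSeries D with hV
  set Lc : PowerSeries ℍ := X - C (star q₀) with hLc
  have hLcconj : Lc = conjSeries (X - C q₀) := by simp [hLc, conjSeries_sub]
  have hEc : ConvOnBall E := convOnBall_X.oneSubRight q₀
  have hDc : ConvOnBall D := hp.oneSubLeft a
  have hVc : ConvOnBall V := (hp.sub (convOnBall_C a)).mul hDc.conjSeries
  have hNc : ConvOnBall N := (hEc.mul hR).mul hDc.conjSeries
  have hL := convOnBall_X_sub_C q₀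
  have hLcc : ConvOnBall Lc := convOnBall_X_sub_C _
  have hSc : ConvOnBall (D * conjSeries D) := hDc.mul hDc.conjSeries
  have hreal := isRealSeries_mul_conjSeries D
  have key : Lc * (X - C q₀) * N = Lc * E * V := by
    rw [hV, hpR, mul_assoc Lc, mul_assoc Lc]
    congr 1
    simp only [N, ← mul_assoc]
    rw [hE, oneSubRight, X_sub_C_mul_one_sub (star_comm_self' q₀).symm]
  have hLreal : IsRealSeries (Lc * (X - C q₀)) := by
    rw [hLcconj, conjSeries_mul_self]; exact isRealSeries_mul_conjSeries _
  have hC : Filter.Tendsto (fun r : ℝ => 1 + (1 - r ^ 2) / (r - ‖q₀‖)) (nhdsWithin 1 (Iio 1))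
      (nhds 1) := by
    have h1 : (1 : ℝ) - ‖q₀‖ ≠ 0 := (sub_pos.2 (mem_unitBall.1 hq₀)).ne'
    have : ContinuousAt (fun r : ℝ => 1 + (1 - r ^ 2) / (r - ‖q₀‖)) 1 := by
      fun_prop (disch := exact h1)
    have h2 := this.tendsto.mono_left (nhdsWithin_le_nhds (s := Iio 1))
    simpa using h2
  refine norm_lt_or_eq_mul_C hNc hSc hreal
    (fun q hq => seriesEval_oneSubLeft_symm_ne_zero hp hp1 ha hq) hC (mem_unitBall.1 hq₀) ?_
  intro q hq hlt
  have hLcq : seriesEval Lc q ≠ 0 := by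
    rw [seriesEval_X_sub_C _ hq, sub_ne_zero]
    rintro rfl
    rw [norm_star] at hlt
    exact hlt.false
  set t := (seriesEval Lc q)⁻¹ * q * seriesEval Lc q with ht
  have htb : t ∈ unitBall := conj_mem_unitBall hLcq hq
  have htn : ‖t‖ = ‖q‖ := norm_conj hLcq q
  have h1 : ‖seriesEval Lc q‖ * ‖t - q₀‖ * ‖seriesEval N q‖ =
      ‖seriesEval (Lc * E * V) q‖ := by
    rw [← key, hLreal.seriesEval_mul (hLcc.mul hL) hNc hq, norm_mul,
      seriesEval_mul hLcc hL hq hLcq, norm_mul, ← ht, seriesEval_X_sub_C _ htb]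
  obtain ⟨c, hc, hceq⟩ := exists_seriesEval_mul (hLcc.mul hEc) hVc hq
  have h2 : ‖seriesEval (Lc * E * V) q‖ ≤
      ‖seriesEval Lc q‖ * ‖1 - t * star q₀‖ * ‖seriesEval (D * conjSeries D) q‖ := by
    rw [hceq, norm_mul, seriesEval_mul hLcc hEc hq hLcq, norm_mul, ← ht, hE,
      seriesEval_oneSubRight_X _ htb, ← hreal.norm_seriesEval_conj hSc hq hc]
    gcongr
    exact (norm_seriesEval_sub_C_mul_lt hp hp1 ha (conj_mem_unitBall hc hq)).le
  have hLpos : 0 < ‖seriesEval Lc q‖ := norm_pos_iff.2 hLcq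
  have h3 : ‖t - q₀‖ * ‖seriesEval N q‖ ≤
      ‖1 - t * star q₀‖ * ‖seriesEval (D * conjSeries D) q‖ := by
    refine le_of_mul_le_mul_left ?_ hLpos
    rw [← mul_assoc, ← mul_assoc, h1]
    exact h2
  have h4 : ‖q‖ - ‖q₀‖ ≤ ‖t - q₀‖ := htn ▸ norm_sub_norm_le t q₀
  have h4' : 0 < ‖q‖ - ‖q₀‖ := sub_pos.2 hlt
  have hq1 := mem_unitBall.1 hq
  have hq2 : 0 ≤ 1 - ‖q‖ ^ 2 := by nlinarith [norm_nonneg q]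
  -- `1 - t conj(q₀) = (1 - |t|²) + t conj(t - q₀)`
  have h5 : ‖1 - t * star q₀‖ ≤ (1 - ‖q‖ ^ 2) + ‖t - q₀‖ := by
    have h6 : 1 - t * star q₀ = ((1 - ‖q‖ ^ 2 : ℝ) : ℍ) + t * star (t - q₀) := by
      rw [star_sub, mul_sub, Quaternion.self_mul_star, Quaternion.normSq_eq_norm_mul_self, htn]
      push_cast
      noncomm_ring
    rw [h6]
    refine (norm_add_le _ _).trans ?_
    rw [Quaternion.norm_coe, Real.norm_of_nonneg hq2, norm_mul, norm_star, htn]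
    gcongr
    exact mul_le_of_le_one_left (norm_nonneg _) hq1.le
  have h7 : ‖1 - t * star q₀‖ ≤ ‖t - q₀‖ * (1 + (1 - ‖q‖ ^ 2) / (‖q‖ - ‖q₀‖)) := by
    refine h5.trans ?_
    rw [mul_add, mul_one, add_comm]
    gcongr
    rw [mul_div_assoc', le_div_iff₀ h4', mul_comm]
    gcongr
  refine le_of_mul_le_mul_left (h3.trans ?_) (h4'.trans_le h4)
  rw [← mul_assoc]
  gcongr

/-! ### Values of the Möbius expressions at the base point and its conjugate -/

/-- If `M * N = Z * Y` with `Z` real, then the quotient of `Y` by a real function `S` has, at each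
point, the modulus of `Z⁻¹ M` times the modulus of `S⁻¹ N` at a conjugate of the point. -/
theorem exists_norm_div_eq {M N Z Y S : PowerSeries ℍ} (hM : ConvOnBall M) (hN : ConvOnBall N)
    (hZ : ConvOnBall Z) (hY : ConvOnBall Y) (hS : ConvOnBall S) (hZr : IsRealSeries Z)
    (hSr : IsRealSeries S) (h : M * N = Z * Y) {q : ℍ} (hq : q ∈ unitBall)
    (hZ0 : seriesEval Z q ≠ 0) : ∃ q' ∈ unitBall,
      ‖(seriesEval S q)⁻¹ * seriesEval Y q‖ =
        ‖(seriesEval Z q)⁻¹ * seriesEval M q‖ * (‖seriesEval N q'‖ / ‖seriesEval S q'‖) := by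
  obtain ⟨c, hc, heq⟩ := exists_seriesEval_mul hM hN hq
  refine ⟨c⁻¹ * q * c, conj_mem_unitBall hc hq, ?_⟩
  have hY' : seriesEval Y q = (seriesEval Z q)⁻¹ * (seriesEval M q *
      seriesEval N (c⁻¹ * q * c)) := by
    rw [← heq, h, hZr.seriesEval_mul hZ hY hq, inv_mul_cancel_left₀ hZ0]
  rw [hSr.norm_seriesEval_conj hS hq hc, hY']
  simp only [norm_mul, norm_inv]
  ring

theorem conjSeries_oneSubRight_X (b : ℍ) :
    conjSeries (oneSubRight b X) = oneSubRight (star b) X := by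
  rw [conjSeries_oneSubRight, oneSubRight, conjSeries_X, star_star, (commute_X (C b)).eq]

theorem one_sub_mul_ne_zero {x y : ℍ} (hx : ‖x‖ < 1) (hy : ‖y‖ < 1) : 1 - x * y ≠ 0 := by
  intro h
  have h1 : ‖(1 : ℍ)‖ < 1 := by
    rw [sub_eq_zero.1 h, norm_mul]
    exact mul_lt_one_of_nonneg_of_lt_one_left (norm_nonneg _) hx hy.le
  simp at h1

theorem seriesEval_oneSubRight_X_symm_ne_zero {b q : ℍ} (hb : b ∈ unitBall) (hq : q ∈ unitBall) :
    seriesEval (oneSubRight b X * conjSeries (oneSubRight b X)) q ≠ 0 := by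
  refine seriesEval_symm_ne_zero (convOnBall_X.oneSubRight b) (fun w hw => ?_) hq
  rw [seriesEval_oneSubRight_X b hw]
  exact one_sub_mul_ne_zero (mem_unitBall.1 hw) (by simpa using mem_unitBall.1 hb)

/-- At points `q` commuting with `b`, the reciprocal `(1 - q conj(b))^{-*}` is the pointwise
one. -/
theorem symm_inv_mul_conjSeries_oneSubRight_X {b q : ℍ} (hb : b ∈ unitBall) (hq : q ∈ unitBall)
    (hc : Commute q b) :
    (seriesEval (oneSubRight b X * conjSeries (oneSubRight b X)) q)⁻¹ *
      seriesEval (conjSeries (oneSubRight b X)) q = (1 - q * star b)⁻¹ := by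
  have hE := convOnBall_X.oneSubRight b
  have h1 : seriesEval (conjSeries (oneSubRight b X)) q = 1 - q * b := by
    rw [conjSeries_oneSubRight_X, seriesEval_oneSubRight_X _ hq, star_star]
  have h2 : 1 - q * b ≠ 0 := one_sub_mul_ne_zero (mem_unitBall.1 hq) (mem_unitBall.1 hb)
  have hcomm : Commute q (seriesEval (conjSeries (oneSubRight b X)) q) := by
    rw [h1]; exact (Commute.one_right q).sub_right ((Commute.refl q).mul_right hc)
  rw [← conjSeries_mul_self, seriesEval_mul_of_commute hE.conjSeries hE hq hcomm, h1,
    seriesEval_oneSubRight_X _ hq, mul_inv_rev, mul_assoc, inv_mul_cancel₀ h2, mul_one]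

section
variable {p R : PowerSeries ℍ} {q₀ : ℍ}

/-- Since `ā f + f^c a = f ā + a f^c`, the symmetrization of `1 - ā * f` at a point where `f` takes
the value `a` is `(1 - |a|²) (1 - f^s)`. -/
theorem seriesEval_oneSubLeft_symm_self (hp : ConvOnBall p) (hq₀ : q₀ ∈ unitBall) :
    seriesEval (oneSubLeft (seriesEval p q₀) p * conjSeries (oneSubLeft (seriesEval p q₀) p)) q₀ =
      (1 - seriesEval (p * conjSeries p) q₀) * ((1 - ‖seriesEval p q₀‖ ^ 2 : ℝ) : ℍ) := by
  set a := seriesEval p q₀ with ha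
  have hCa := convOnBall_C a
  have hCs := convOnBall_C (star a)
  have hpc := hp.conjSeries
  have h1 : seriesEval (C a * conjSeries p) q₀ = seriesEval (p * conjSeries p) q₀ := by
    have := hCa.hasSum_mul hpc hq₀
    rw [seriesEval_C a hq₀] at this
    exact this.unique (hp.hasSum_mul hpc hq₀)
  rw [oneSubLeft_symm, trace_comm, seriesEval_add (convOnBall_one.sub
      ((hp.mul hCs).add (hCa.mul hpc))) ((hp.mul hpc).mul (hCs.mul hCa)) hq₀,
    seriesEval_sub convOnBall_one ((hp.mul hCs).add (hCa.mul hpc)) hq₀, seriesEval_one hq₀,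
    seriesEval_add (hp.mul hCs) (hCa.mul hpc) hq₀, seriesEval_mul_C hp _ hq₀, h1, ← map_mul,
    seriesEval_mul_C (hp.mul hpc) _ hq₀, ← ha, Quaternion.self_mul_star, Quaternion.star_mul_self,
    Quaternion.normSq_eq_norm_mul_self, pow_two]
  push_cast
  noncomm_ring

theorem seriesEval_eq_sub_mul (hp : ConvOnBall p) (hR : ConvOnBall R)
    {a : ℍ} (hpR : p - C a = (X - C q₀) * R) {q : ℍ} (hq : q ∈ unitBall) (hc : Commute q q₀) :
    seriesEval p q - a = (q - q₀) * seriesEval R q := by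
  have hcomm : Commute q (seriesEval (X - C q₀) q) := by
    rw [seriesEval_X_sub_C _ hq]; exact (Commute.refl q).sub_right hc
  rw [← seriesEval_X_sub_C q₀ hq,
    ← seriesEval_mul_of_commute (convOnBall_X_sub_C q₀) hR hq hcomm, ← hpR,
    seriesEval_sub hp (convOnBall_C a) hq, seriesEval_C a hq]

theorem commute_star_self (q : ℍ) : Commute (star q) q := (star_comm_self' q)

/-- The value of `R * f^c` at `conj(q₀)`, where `f - f(q₀) = (q - q₀) * R`. -/
theorem seriesEval_mul_conjSeries_star (hp : ConvOnBall p) (hR : ConvOnBall R)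
    (hq₀ : q₀ ∈ unitBall) (hpR : p - C (seriesEval p q₀) = (X - C q₀) * R) :
    seriesEval (R * conjSeries p) (star q₀) =
      seriesEval R (star q₀) * star (seriesEval p q₀) := by
  set a := seriesEval p q₀ with ha
  have hCa := convOnBall_C a
  have hCs := convOnBall_C (star a)
  have hpc := hp.conjSeries
  have hs₀ := star_mem_unitBall hq₀
  have hL := convOnBall_X_sub_C q₀
  by_cases hr : star q₀ = q₀
  · have hall : ∀ x : ℍ, Commute (star q₀) x := fun x => by
      rw [hr, Quaternion.star_eq_self.1 hr]; exact Quaternion.coe_commutes _ _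
    have h1 : seriesEval (conjSeries p) (star q₀) = star a := by
      refine (hpc.hasRegSeries _ hs₀).unique
        ((hp.hasRegSeries q₀ hq₀).star.congr_fun fun n => ?_)
      rw [coeff_conjSeries, star_mul, star_pow, ((hall _).pow_left n).eq]
    rw [seriesEval_mul_of_commute hR hpc hs₀ (hall _), h1]
  · have h1 : seriesEval (C a * conjSeries p) q₀ = seriesEval (p * conjSeries p) q₀ := by
      have := hCa.hasSum_mul hpc hq₀
      rw [seriesEval_C a hq₀] at this
      exact this.unique (hp.hasSum_mul hpc hq₀)
    have htr : IsRealSeries (p * C (star a) + C a * conjSeries p) := by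
      have := isRealSeries_add_conjSeries (p * C (star a))
      rwa [conjSeries_mul, conjSeries_C, star_star] at this
    have htc : ConvOnBall (p * C (star a) + C a * conjSeries p) :=
      (hp.mul hCs).add (hCa.mul hpc)
    have h2 := htr.seriesEval_star htc hq₀
    rw [seriesEval_add (hp.mul hCs) (hCa.mul hpc) hs₀, seriesEval_add (hp.mul hCs) (hCa.mul hpc) hq₀,
      h1, seriesEval_mul_C hp _ hs₀, seriesEval_mul_C hp _ hq₀, ← ha, star_add,
      ← (isRealSeries_mul_conjSeries p).seriesEval_star (hp.mul hpc) hq₀, star_mul, star_star] at h2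
    have hcomm : Commute (star q₀) (seriesEval (X - C q₀) (star q₀)) := by
      rw [seriesEval_X_sub_C _ hs₀]
      exact (Commute.refl _).sub_right (commute_star_self q₀)
    have h3 : (star q₀ - q₀) * seriesEval (R * conjSeries p) (star q₀) =
        (star q₀ - q₀) * (seriesEval R (star q₀) * star a) := by
      rw [← mul_assoc, ← seriesEval_eq_sub_mul hp hR hpR hs₀ (commute_star_self q₀)]
      conv_lhs => rw [← seriesEval_X_sub_C q₀ hs₀]
      rw [← seriesEval_mul_of_commute hL (hR.mul hpc) hs₀ hcomm, ← mul_assoc, ← hpR, sub_mul,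
        seriesEval_sub (hp.mul hpc) (hCa.mul hpc) hs₀, sub_mul]
      rw [sub_eq_sub_iff_add_eq_add, ← h2.symm]
      abel
    exact mul_left_cancel₀ (sub_ne_zero.2 hr) h3

/-- The value of the numerator of `R * (1 - ā * f)^{-*}` at `conj(q₀)`, where `a = f(q₀)`. -/
theorem seriesEval_mul_conjSeries_oneSubLeft_star (hp : ConvOnBall p) (hR : ConvOnBall R)
    (hq₀ : q₀ ∈ unitBall) (hpR : p - C (seriesEval p q₀) = (X - C q₀) * R) :
    seriesEval (R * conjSeries (oneSubLeft (seriesEval p q₀) p)) (star q₀) =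
      seriesEval R (star q₀) * ((1 - ‖seriesEval p q₀‖ ^ 2 : ℝ) : ℍ) := by
  have hs₀ := star_mem_unitBall hq₀
  have hpc := hp.conjSeries
  rw [conjSeries_oneSubLeft, mul_sub, mul_one, ← mul_assoc,
    seriesEval_sub hR ((hR.mul hpc).mul (convOnBall_C _)) hs₀,
    seriesEval_mul_C (hR.mul hpc) _ hs₀, seriesEval_mul_conjSeries_star hp hR hq₀ hpR, mul_assoc,
    Quaternion.star_mul_self, Quaternion.normSq_eq_norm_mul_self, pow_two]
  push_cast
  noncomm_ring

/-- The Leibniz rule for `f = a + (q - q₀) * R`. -/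
theorem seriesDeriv_eq {a : ℍ} (hpR : p - C a = (X - C q₀) * R) :
    seriesDeriv p = R + (X - C q₀) * seriesDeriv R := by
  have hco : ∀ n, coeff (n + 1) p = coeff n R - q₀ * coeff (n + 1) R := by
    intro n
    have := congrArg (coeff (n + 1)) hpR
    rwa [map_sub, coeff_succ_C, sub_zero, sub_mul, map_sub, coeff_succ_X_mul, coeff_C_mul] at this
  ext1 n
  rw [coeff_seriesDeriv, hco, map_add, sub_mul, map_sub, coeff_C_mul, coeff_seriesDeriv]
  cases n with
  | zero => simp [sub_eq_add_neg]
  | succ n =>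
    rw [coeff_succ_X_mul, coeff_seriesDeriv, mul_smul_comm]
    push_cast
    module

theorem seriesEval_seriesDeriv_mul (hp' : ConvOnBall (seriesDeriv R)) (hR : ConvOnBall R) {a : ℍ}
    (hq₀ : q₀ ∈ unitBall) (hpR : p - C a = (X - C q₀) * R) {Y : PowerSeries ℍ}
    (hY : ConvOnBall Y) :
    seriesEval (seriesDeriv p * Y) q₀ = seriesEval (R * Y) q₀ := by
  have hL := convOnBall_X_sub_C q₀
  rw [seriesDeriv_eq hpR, add_mul, seriesEval_add (hR.mul hY) ((hL.mul hp').mul hY) hq₀, mul_assoc,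
    seriesEval_mul_eq_zero hL (hp'.mul hY) hq₀ (by rw [seriesEval_X_sub_C _ hq₀, sub_self]),
    add_zero]

end

/-! ### Regular Möbius transformations -/

/-- The series of the affine function `q α + β`. -/
def affineSeries (α β : ℍ) : PowerSeries ℍ := X * C α + C β

theorem hasRegSeries_affine (α β : ℍ) :
    HasRegSeries (fun q => q * α + β) (affineSeries α β) :=
  (hasRegSeries_X.mul_C α).add (hasRegSeries_C β)

theorem convOnBall_affineSeries (α β : ℍ) : ConvOnBall (affineSeries α β) :=
  (hasRegSeries_affine α β).convOnBall

theorem seriesEval_affineSeries (α β : ℍ) {q : ℍ} (hq : q ∈ unitBall) :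
    seriesEval (affineSeries α β) q = q * α + β :=
  ((hasRegSeries_affine α β).eq_seriesEval hq).symm

theorem affineSeries_mul_C (α β c : ℍ) :
    affineSeries α β * C c = affineSeries (α * c) (β * c) := by
  simp [affineSeries, add_mul, mul_assoc]

theorem C_mul_affineSeries (α β c : ℍ) :
    C c * affineSeries α β = affineSeries (c * α) (c * β) := by
  rw [affineSeries, mul_add, ← mul_assoc, (commute_X (C c)).eq, mul_assoc, ← map_mul, ← map_mul,
    affineSeries]

theorem affineSeries_sub (α β γ δ : ℍ) :
    affineSeries α β - affineSeries γ δ = affineSeries (α - γ) (β - δ) := by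
  simp only [affineSeries, map_sub, mul_sub]; abel

theorem leftQuot_eq {f g : ℍ → ℍ} {p p' : PowerSeries ℍ} (hf : HasRegSeries f p)
    (hg : HasRegSeries g p') (q : ℍ) : leftQuot f g q =
      (seriesEval (p * conjSeries p) q)⁻¹ * seriesEval (conjSeries p * p') q := by
  have hc : HasRegSeries (regConj f) (conjSeries p) := by
    rw [regConj, hf.regSeries_eq]; exact hf.convOnBall.conjSeries.hasRegSeries
  rw [leftQuot, regSymm, starMul, starMul, hf.regSeries_eq, hg.regSeries_eq, hc.regSeries_eq]

theorem regSymm_eq {f : ℍ → ℍ} {p : PowerSeries ℍ} (hf : HasRegSeries f p) :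
    regSymm f = seriesEval (p * conjSeries p) := by
  have hc : HasRegSeries (regConj f) (conjSeries p) := by
    rw [regConj, hf.regSeries_eq]; exact hf.convOnBall.conjSeries.hasRegSeries
  rw [regSymm, starMul, hf.regSeries_eq, hc.regSeries_eq]

theorem rightQuot_eq {f g : ℍ → ℍ} {p p' : PowerSeries ℍ} (hf : HasRegSeries f p)
    (hg : HasRegSeries g p') (q : ℍ) : rightQuot g f q =
      (seriesEval (p * conjSeries p) q)⁻¹ * seriesEval (p' * conjSeries p) q := by
  have hc : HasRegSeries (regConj f) (conjSeries p) := by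
    rw [regConj, hf.regSeries_eq]; exact hf.convOnBall.conjSeries.hasRegSeries
  rw [rightQuot, regSymm, starMul, starMul, hf.regSeries_eq, hg.regSeries_eq, hc.regSeries_eq]

/-- A self-map `f` of the ball with `(q γ + δ) * f = q α + β` is a regular Möbius transformation
as soon as the denominator has no zero in the ball and the pointwise Möbius transformation with the
same coefficients is onto the ball. -/
theorem isRegularMobius_of_mul_eq {f : ℍ → ℍ} {p : PowerSeries ℍ} {α β γ δ : ℍ}
    (hf : HasRegSeries f p) (hmaps : MapsTo f unitBall unitBall)
    (h : affineSeries γ δ * p = affineSeries α β) (hu : IsUnit !![α, γ; β, δ])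
    (h0 : ∀ q ∈ unitBall, q * γ + δ ≠ 0)
    (hsurj : ∀ y ∈ unitBall, ∃ q ∈ unitBall, q * α + β = (q * γ + δ) * y) :
    IsRegularMobius f := by
  have hp := hf.convOnBall
  have hden := hasRegSeries_affine γ δ
  have hdc := hden.convOnBall
  have hZ0 : ∀ q ∈ unitBall,
      seriesEval (affineSeries γ δ * conjSeries (affineSeries γ δ)) q ≠ 0 := fun q hq =>
    seriesEval_symm_ne_zero hdc
      (fun w hw => by rw [seriesEval_affineSeries _ _ hw]; exact h0 w hw) hq
  refine ⟨!![α, γ; β, δ], hu, fun q hq => ?_, fun q hq => ?_, ?_⟩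
  · simpa [regSymm_eq hden] using hZ0 q hq
  · have : f q = leftQuot (fun w => w * γ + δ) (fun w => w * α + β) q := by
      rw [leftQuot_eq hden (hasRegSeries_affine α β), ← h, ← mul_assoc, conjSeries_mul_self,
        (isRealSeries_mul_conjSeries _).seriesEval_mul (hdc.mul hdc.conjSeries) hp hq,
        inv_mul_cancel_left₀ (hZ0 q hq), hf.eq_seriesEval hq]
    simpa using this
  · refine Subset.antisymm (image_subset_iff.2 hmaps) fun y hy => ?_
    obtain ⟨q, hq, hqy⟩ := hsurj y hy
    obtain ⟨c, hc, heq⟩ := exists_seriesEval_mul hdc (hp.sub (convOnBall_C y)) hq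
    have ht := conj_mem_unitBall hc hq
    refine ⟨c⁻¹ * q * c, ht, ?_⟩
    rw [mul_sub, h, affineSeries_mul_C, affineSeries_sub, seriesEval_affineSeries _ _ hq,
      seriesEval_affineSeries _ _ hq, seriesEval_sub hp (convOnBall_C y) ht, seriesEval_C y ht,
      ← hf.eq_seriesEval ht] at heq
    have hz : q * (α - γ * y) + (β - δ * y) = 0 := by
      rw [mul_sub, ← mul_assoc, sub_add_sub_comm, ← add_mul, hqy, sub_self]
    rw [hz] at heq
    exact sub_eq_zero.1 ((mul_eq_zero.1 heq.symm).resolve_left (h0 q hq))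

/-- The relations that say that the rows `(α, γ)` and `(β, δ)` are orthogonal, of opposite and
nonzero norm squares, for the Hermitian form `x conj(x') - y conj(y')` of signature `(1, 1)`. -/
structure RowsPseudoOrthogonal (α β γ δ : ℍ) : Prop where
  cross : α * star β = γ * star δ
  diag : ‖α‖ ^ 2 - ‖γ‖ ^ 2 = ‖δ‖ ^ 2 - ‖β‖ ^ 2
  pos : ‖β‖ < ‖δ‖

theorem quaternion_norm_add_sq (x y : ℍ) :
    ‖x + y‖ ^ 2 = ‖x‖ ^ 2 + ‖y‖ ^ 2 + 2 * (x * star y).re := by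
  simp only [pow_two, ← Quaternion.normSq_eq_norm_mul_self]
  exact Quaternion.normSq_add x y

/-- A quaternionic Möbius transformation `(q γ + δ)⁻¹ (q α + β)` of the ball onto itself preserves
the unit sphere, so its matrix is unitary for the form of signature `(1, 1)`, up to a factor. -/
theorem rowsPseudoOrthogonal_of_bijective {α β γ δ : ℍ} (hu : IsUnit !![α, γ; β, δ])
    (hlt : ∀ q ∈ unitBall, ‖q * α + β‖ < ‖q * γ + δ‖)
    (hsurj : ∀ y ∈ unitBall, ∃ q ∈ unitBall, q * α + β = (q * γ + δ) * y) :
    RowsPseudoOrthogonal α β γ δ := by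
  have hindep : ∀ y : ℍ, α - γ * y = 0 → β - δ * y ≠ 0 := by
    intro y h1 h2
    obtain ⟨B, hB⟩ := hu.exists_left_inv
    have h3 := congrFun (congrFun hB 0) 0
    have h4 := congrFun (congrFun hB 0) 1
    simp only [Matrix.mul_apply, Fin.sum_univ_two, Matrix.of_apply, Matrix.cons_val',
      Matrix.cons_val_zero, Matrix.cons_val_one, Matrix.cons_val_fin_one, Matrix.one_apply_eq] at h3 h4
    rw [Matrix.one_apply_ne (by decide)] at h4
    rw [sub_eq_zero.1 h1, sub_eq_zero.1 h2, ← mul_assoc, ← mul_assoc, ← add_mul, h4, zero_mul] at h3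
    exact zero_ne_one h3
  have hle : ∀ q : ℍ, ‖q‖ = 1 → ‖q * α + β‖ ≤ ‖q * γ + δ‖ := by
    intro q hq
    have hcl : IsClosed {q : ℍ | ‖q * α + β‖ ≤ ‖q * γ + δ‖} :=
      isClosed_le (by fun_prop) (by fun_prop)
    have hsub := hcl.closure_subset_iff.2 fun q (hq : q ∈ unitBall) => (hlt q hq).le
    rw [closure_ball _ one_ne_zero] at hsub
    exact hsub (mem_closedBall_zero_iff.2 hq.le)
  -- a sphere point mapped inside the ball would share its image with an interior point
  have heq : ∀ q : ℍ, ‖q‖ = 1 → ‖q * α + β‖ = ‖q * γ + δ‖ := by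
    intro q hq
    refine (hle q hq).eq_of_not_lt fun hl => ?_
    have hd : q * γ + δ ≠ 0 := norm_pos_iff.1 ((norm_nonneg _).trans_lt hl)
    set y := (q * γ + δ)⁻¹ * (q * α + β) with hy
    have hyb : y ∈ unitBall := by
      rw [mem_unitBall, hy, norm_mul, norm_inv, inv_mul_lt_iff₀ (norm_pos_iff.2 hd), mul_one]
      exact hl
    obtain ⟨r, hr, hry⟩ := hsurj y hyb
    have h1 : ∀ s : ℍ, s * α + β = (s * γ + δ) * y → s * (α - γ * y) = -(β - δ * y) := by
      intro s hs
      rw [mul_sub, eq_neg_iff_add_eq_zero, sub_add_sub_comm, hs, add_mul, mul_assoc, sub_self]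
    have h2 := h1 q (by rw [hy, mul_inv_cancel_left₀ hd])
    have h3 := h1 r hry
    have h4 : α - γ * y ≠ 0 := by
      intro h0
      refine hindep y h0 ?_
      rw [h0, mul_zero] at h2
      exact neg_eq_zero.1 h2.symm
    have h5 : q = r := mul_right_cancel₀ h4 (h2.trans h3.symm)
    rw [h5] at hq
    exact (mem_unitBall.1 hr).ne hq
  set κ := α * star β - γ * star δ with hκ
  have hform : ∀ q : ℍ, ‖q‖ = 1 →
      ‖α‖ ^ 2 + ‖β‖ ^ 2 - ‖γ‖ ^ 2 - ‖δ‖ ^ 2 + 2 * (q * κ).re = 0 := by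
    intro q hq
    have := congrArg (· ^ 2) (heq q hq)
    simp only [quaternion_norm_add_sq, norm_mul, hq, one_mul] at this
    rw [hκ, mul_sub, Quaternion.re_sub, ← mul_assoc, ← mul_assoc]
    linarith
  have h1 := hform 1 norm_one
  have h2 := hform (-1) (by simp)
  rw [one_mul] at h1
  rw [neg_one_mul, Quaternion.re_neg] at h2
  have hκ0 : κ = 0 := by
    by_contra hne
    have hn : ‖κ‖ ≠ 0 := norm_ne_zero_iff.2 hne
    have h3 := hform ((‖κ‖⁻¹ : ℝ) • star κ) (by
      rw [norm_smul, norm_star, norm_inv, norm_norm, inv_mul_cancel₀ hn])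
    rw [smul_mul_assoc, Quaternion.re_smul, Quaternion.star_mul_self, Quaternion.re_coe,
      Quaternion.normSq_eq_norm_mul_self, smul_eq_mul, inv_mul_cancel_left₀ hn] at h3
    apply hn
    linarith
  refine ⟨sub_eq_zero.1 hκ0, by linarith, ?_⟩
  simpa using hlt 0 (mem_ball_self one_pos)

/-- Multiplying the matrix on the right by the one of `(w - a) (1 - ā w)⁻¹` scales the Hermitian
form of signature `(1, 1)` by `1 - |a|²`. -/
theorem pseudo_form_identity (a x y z w : ℍ) :
    (x - y * a) * star (z - w * a) - (y - x * star a) * star (w - z * star a) =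
      ((1 - ‖a‖ ^ 2 : ℝ) : ℍ) * (x * star z - y * star w) := by
  have h1 : ∀ s t : ℍ, s * star a * (a * t) = ((‖a‖ ^ 2 : ℝ) : ℍ) * (s * t) := by
    intro s t
    rw [mul_assoc, ← mul_assoc (star a), Quaternion.star_mul_self,
      Quaternion.normSq_eq_norm_mul_self, ← pow_two, ← mul_assoc, ← Quaternion.coe_commutes,
      mul_assoc]
  have h2 : ∀ s t : ℍ, s * a * (star a * t) = ((‖a‖ ^ 2 : ℝ) : ℍ) * (s * t) := by
    intro s t
    rw [mul_assoc, ← mul_assoc a, Quaternion.self_mul_star,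
      Quaternion.normSq_eq_norm_mul_self, ← pow_two, ← mul_assoc, ← Quaternion.coe_commutes,
      mul_assoc]
  simp only [star_sub, star_mul, star_star, sub_mul, mul_sub, h1, h2]
  push_cast
  noncomm_ring

theorem coe_norm_sq (x : ℍ) : ((‖x‖ ^ 2 : ℝ) : ℍ) = x * star x := by
  rw [Quaternion.self_mul_star, Quaternion.normSq_eq_norm_mul_self, pow_two]

theorem norm_sq_sub_norm_sq (a x y : ℍ) :
    ‖x - y * a‖ ^ 2 - ‖y - x * star a‖ ^ 2 = (1 - ‖a‖ ^ 2) * (‖x‖ ^ 2 - ‖y‖ ^ 2) := by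
  have := pseudo_form_identity a x y x y
  rw [← coe_norm_sq, ← coe_norm_sq, ← coe_norm_sq, ← coe_norm_sq] at this
  exact Quaternion.coe_injective (by exact_mod_cast this)

theorem RowsPseudoOrthogonal.comp {α β γ δ a : ℍ} (h : RowsPseudoOrthogonal α β γ δ)
    (ha : ‖a‖ < 1) :
    RowsPseudoOrthogonal (α - γ * a) (β - δ * a) (γ - α * star a) (δ - β * star a) := by
  have ha2 : 0 < 1 - ‖a‖ ^ 2 := by nlinarith [norm_nonneg a]
  have h1 := pseudo_form_identity a α γ β δ
  rw [h.cross, sub_self, mul_zero] at h1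
  have h2 := norm_sq_sub_norm_sq a α γ
  have h3 := norm_sq_sub_norm_sq a β δ
  refine ⟨sub_eq_zero.1 h1, by rw [h2, h.diag]; linarith, ?_⟩
  refine lt_of_pow_lt_pow_left₀ 2 (norm_nonneg _) ?_
  have h4 : ‖β‖ ^ 2 < ‖δ‖ ^ 2 := pow_lt_pow_left₀ h.pos (norm_nonneg _) two_ne_zero
  nlinarith

/-- The normal form: after division by `δ` on the left, an affine pair with pseudo-orthogonal rows
becomes the numerator and denominator of `(1 - q conj(b))^{-*} * (q - b) u` with `|b| < 1` and
`|u| = 1`. -/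
theorem RowsPseudoOrthogonal.normalForm {α β γ δ : ℍ} (h : RowsPseudoOrthogonal α β γ δ) :
    ∃ b u : ℍ, ‖b‖ < 1 ∧ ‖u‖ = 1 ∧
      C δ⁻¹ * affineSeries γ δ = oneSubRight b X ∧
      C δ⁻¹ * affineSeries α β = (X - C b) * C u := by
  have hδn : 0 < ‖δ‖ := (norm_nonneg β).trans_lt h.pos
  have hδ : δ ≠ 0 := norm_pos_iff.1 hδn
  have hαβ : ‖α‖ * ‖β‖ = ‖γ‖ * ‖δ‖ := by
    simpa using congrArg norm h.cross
  have hα : ‖α‖ = ‖δ‖ := by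
    refine (pow_left_inj₀ (norm_nonneg _) (norm_nonneg _) two_ne_zero).1 ?_
    have h4 : ‖β‖ ^ 2 < ‖δ‖ ^ 2 := pow_lt_pow_left₀ h.pos (norm_nonneg _) two_ne_zero
    have h5 : ‖α‖ ^ 2 * ‖β‖ ^ 2 = ‖γ‖ ^ 2 * ‖δ‖ ^ 2 := by rw [← mul_pow, hαβ, mul_pow]
    have h6 := h.diag
    have h7 : (‖δ‖ ^ 2 - ‖β‖ ^ 2) * (‖α‖ ^ 2 - ‖δ‖ ^ 2) = 0 := by
      linear_combination ‖δ‖ ^ 2 * h6 - h5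
    exact sub_eq_zero.1 ((mul_eq_zero.1 h7).resolve_left (by linarith))
  set u := δ⁻¹ * α with hu
  have hu1 : ‖u‖ = 1 := by rw [hu, norm_mul, norm_inv, hα, inv_mul_cancel₀ hδn.ne']
  have huu : star u * u = 1 := by
    rw [Quaternion.star_mul_self, Quaternion.normSq_eq_norm_mul_self, hu1]; simp
  refine ⟨-(δ⁻¹ * β * star u), u, ?_, hu1, ?_, ?_⟩
  · rw [norm_neg, norm_mul, norm_star, hu1, mul_one, norm_mul, norm_inv, inv_mul_lt_iff₀ hδn,
      mul_one]
    exact h.pos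
  · have h1 : δ⁻¹ * γ = u * star (δ⁻¹ * β) := by
      rw [hu, star_mul, mul_assoc δ⁻¹ α, ← mul_assoc α, h.cross, mul_assoc γ, ← star_mul,
        inv_mul_cancel₀ hδ, star_one, mul_one]
    rw [C_mul_affineSeries, inv_mul_cancel₀ hδ, h1, affineSeries, oneSubRight, star_neg,
      star_mul (δ⁻¹ * β), star_star, map_neg, mul_neg, sub_neg_eq_add, add_comm, map_one]
  · rw [C_mul_affineSeries, affineSeries, sub_mul, ← map_mul, neg_mul, mul_assoc _ (star u), huu,
      mul_one, map_neg, sub_neg_eq_add]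

theorem ne_zero_of_seriesEval_ne_zero {p : PowerSeries ℍ} {q : ℍ} (h : seriesEval p q ≠ 0) :
    p ≠ 0 := by
  rintro rfl
  exact h (by simp [seriesEval])

theorem X_sub_C_quaternion_ne_zero (b : ℍ) : (X - C b : PowerSeries ℍ) ≠ 0 := fun h => by
  simpa [coeff_C] using congrArg (coeff 1) h

/-- For a self-map with `(q γ + δ) * f = q α + β` and pseudo-orthogonal rows, the quotient of the
Möbius transform of `f` by the one of the variable is constant. -/
theorem eq_mul_C_of_rowsPseudoOrthogonal {p R : PowerSeries ℍ} {q₀ a α β γ δ : ℍ}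
    (hp : ConvOnBall p) (hp1 : ∀ q ∈ unitBall, ‖seriesEval p q‖ < 1) (ha : ‖a‖ < 1)
    (hq₀ : q₀ ∈ unitBall) (hR : ConvOnBall R) (hpR : p - C a = (X - C q₀) * R)
    (h : affineSeries γ δ * p = affineSeries α β) (hrows : RowsPseudoOrthogonal α β γ δ) :
    ∃ u : ℍ, ‖u‖ = 1 ∧ oneSubRight q₀ X * R * conjSeries (oneSubLeft a p) =
      oneSubLeft a p * conjSeries (oneSubLeft a p) * C u := by
  obtain ⟨b, u, hb, hu, h1, h2⟩ := (hrows.comp ha).normalForm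
  have hB : affineSeries γ δ * oneSubRight a p =
      affineSeries (γ - α * star a) (δ - β * star a) := by
    rw [oneSubRight, mul_sub, mul_one, ← mul_assoc, h, affineSeries_mul_C, affineSeries_sub]
  have hW : affineSeries γ δ * (p - C a) = affineSeries (α - γ * a) (β - δ * a) := by
    rw [mul_sub, h, affineSeries_mul_C, affineSeries_sub]
  set D := oneSubLeft a p
  have hDc : ConvOnBall D := hp.oneSubLeft a
  have hSr := isRealSeries_mul_conjSeries D
  have hSc : ConvOnBall (D * conjSeries D) := hDc.mul hDc.conjSeries
  set V := (p - C a) * conjSeries D with hV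
  have hVc : ConvOnBall V := (hp.sub (convOnBall_C a)).mul hDc.conjSeries
  have key : oneSubRight b X * V = D * conjSeries D * ((X - C b) * C u) := by
    rw [← h1, ← h2, ← hB, ← hW, hV, sub_C_mul_conjSeries_oneSubLeft, ← mul_assoc _ _ (p - C a),
      mul_assoc (C _) _ (conjSeries _), mul_assoc (affineSeries γ δ), oneSubRight_symm,
      ← mul_assoc (C _), ← hSr.mul_comm, mul_assoc, mul_assoc (C _)]
  have hL := convOnBall_X_sub_C b
  have hE := convOnBall_X.oneSubRight b
  have hbb : b ∈ unitBall := mem_unitBall.2 hb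
  have hV0 : seriesEval V q₀ = 0 := by
    rw [hV, hpR, mul_assoc]
    exact seriesEval_mul_eq_zero (convOnBall_X_sub_C q₀) (hR.mul hDc.conjSeries) hq₀
      (by rw [seriesEval_X_sub_C _ hq₀, sub_self])
  -- both sides of `key`, multiplied by the conjugate of `1 - q b̄`, are evaluated at `q₀`
  have hbq : b = q₀ := by
    have h3 : oneSubRight b X * conjSeries (oneSubRight b X) * V =
        D * conjSeries D * ((X - C b) * conjSeries (oneSubRight b X) * C u) := by
      rw [← conjSeries_mul_self, mul_assoc, key, ← mul_assoc, ← hSr.mul_comm, mul_assoc,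
        ← mul_assoc _ (X - C b), conjSeries_oneSubRight_X, oneSubRight, star_star,
        X_sub_C_mul_one_sub (Commute.refl b)]
    have h4 := congrArg (seriesEval · q₀) h3
    beta_reduce at h4
    rw [(isRealSeries_mul_conjSeries _).seriesEval_mul (hE.mul hE.conjSeries) hVc hq₀, hV0,
      mul_zero, hSr.seriesEval_mul hSc ((hL.mul hE.conjSeries).mul (convOnBall_C u)) hq₀,
      seriesEval_mul_C (hL.mul hE.conjSeries) u hq₀] at h4
    have hu0 : u ≠ 0 := norm_ne_zero_iff.1 (by rw [hu]; exact one_ne_zero)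
    have h5 := (mul_eq_zero.1 h4.symm).resolve_left
      (seriesEval_oneSubLeft_symm_ne_zero hp hp1 ha hq₀)
    have h6 := (mul_eq_zero.1 h5).resolve_right hu0
    obtain ⟨c, hc, heq⟩ := exists_seriesEval_mul hL hE.conjSeries hq₀
    rw [heq, seriesEval_X_sub_C _ hq₀, conjSeries_oneSubRight_X,
      seriesEval_oneSubRight_X _ (conj_mem_unitBall hc hq₀), star_star] at h6
    have h7 := (mul_eq_zero.1 h6).resolve_right (one_sub_mul_ne_zero
      (mem_unitBall.1 (conj_mem_unitBall hc hq₀)) hb)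
    exact (sub_eq_zero.1 h7).symm
  subst hbq
  refine ⟨u, hu, mul_left_cancel₀ (X_sub_C_quaternion_ne_zero b) ?_⟩
  rw [← mul_assoc, ← mul_assoc, oneSubRight, X_sub_C_mul_one_sub (star_comm_self' b).symm,
    mul_assoc _ (X - C b), ← hpR, mul_assoc, ← hV, ← oneSubRight, key, ← mul_assoc, ← mul_assoc,
    hSr.mul_comm (X - C b), mul_assoc]

/-- Every regular Möbius transformation of the ball is in the equality case of the Schwarz-Pick
dichotomy. -/
theorem IsRegularMobius.eq_mul_C {f : ℍ → ℍ} {p R : PowerSeries ℍ} {q₀ a : ℍ}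
    (hM : IsRegularMobius f) (hf : HasRegSeries f p) (ha : ‖a‖ < 1) (hq₀ : q₀ ∈ unitBall)
    (hR : ConvOnBall R) (hpR : p - C a = (X - C q₀) * R) :
    ∃ u : ℍ, ‖u‖ = 1 ∧ oneSubRight q₀ X * R * conjSeries (oneSubLeft a p) =
      oneSubLeft a p * conjSeries (oneSubLeft a p) * C u := by
  obtain ⟨A, hA, hsymm, hEq, himg⟩ := hM
  set α := A 0 0
  set β := A 1 0
  set γ := A 0 1
  set δ := A 1 1
  have hA' : A = !![α, γ; β, δ] := Matrix.eta_fin_two A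
  rw [hA'] at hA
  have hp := hf.convOnBall
  have hp1 : ∀ q ∈ unitBall, ‖seriesEval p q‖ < 1 := fun q hq => by
    rw [← hf.eq_seriesEval hq, ← mem_unitBall, ← himg]; exact mem_image_of_mem f hq
  have hden := hasRegSeries_affine γ δ
  have hnum := hasRegSeries_affine α β
  have hdc := hden.convOnBall
  set Z := affineSeries γ δ * conjSeries (affineSeries γ δ) with hZ
  have hZc : ConvOnBall Z := hdc.mul hdc.conjSeries
  have hZr : IsRealSeries Z := isRealSeries_mul_conjSeries _
  have hZ0 : ∀ q ∈ unitBall, seriesEval Z q ≠ 0 := fun q hq => by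
    have := hsymm q hq
    rwa [regSymm_eq hden] at this
  have hZ' : Z = conjSeries (affineSeries γ δ) * affineSeries γ δ := (conjSeries_mul_self _).symm
  have h0b : (0 : ℍ) ∈ unitBall := mem_ball_self one_pos
  have h : affineSeries γ δ * p = affineSeries α β := by
    have h1 : Z * p = conjSeries (affineSeries γ δ) * affineSeries α β := by
      refine (hZc.mul hp).hasRegSeries.unique
        ((hdc.conjSeries.mul hnum.convOnBall).hasRegSeries.congr fun q hq => ?_)
      rw [hZr.seriesEval_mul hZc hp hq, ← hf.eq_seriesEval hq, hEq hq, leftQuot_eq hden hnum,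
        mul_inv_cancel_left₀ (hZ0 q hq)]
    rw [hZ', mul_assoc] at h1
    refine mul_left_cancel₀ (fun hz => ?_) h1
    refine hZ0 0 h0b ?_
    rw [hZ', hz, zero_mul]
    simp [seriesEval]
  have hd0 : ∀ q ∈ unitBall, q * γ + δ ≠ 0 := fun q hq => by
    rw [← seriesEval_affineSeries γ δ hq]
    exact seriesEval_ne_zero_of_symm hdc hdc.conjSeries hq (hZ0 q hq)
  refine eq_mul_C_of_rowsPseudoOrthogonal hp hp1 ha hq₀ hR hpR h
    (rowsPseudoOrthogonal_of_bijective hA (fun q hq => ?_) fun y hy => ?_)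
  · obtain ⟨c, hc, heq⟩ := exists_seriesEval_mul hdc hp hq
    rw [h, seriesEval_affineSeries _ _ hq, seriesEval_affineSeries _ _ hq] at heq
    rw [heq, norm_mul]
    exact mul_lt_of_lt_one_right (norm_pos_iff.2 (hd0 q hq)) (hp1 _ (conj_mem_unitBall hc hq))
  · obtain ⟨q, hq, rfl⟩ : y ∈ f '' unitBall := by rw [himg]; exact hy
    have hs : conjSeries (affineSeries γ δ) * (affineSeries γ δ * (p - C (f q))) =
        Z * (p - C (f q)) := by rw [hZ', mul_assoc]
    have hpc : ConvOnBall (p - C (f q)) := hp.sub (convOnBall_C _)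
    have hc0 : seriesEval (conjSeries (affineSeries γ δ)) q ≠ 0 :=
      seriesEval_ne_zero_of_symm hdc.conjSeries hdc hq (by rw [← hZ']; exact hZ0 q hq)
    have h3 := seriesEval_mul hdc.conjSeries (hdc.mul hpc) hq hc0
    have ht := conj_mem_unitBall hc0 hq
    rw [hs, hZr.seriesEval_mul hZc hpc hq, seriesEval_sub hp (convOnBall_C _) hq,
      seriesEval_C _ hq, ← hf.eq_seriesEval hq, sub_self, mul_zero, mul_sub, h,
      affineSeries_mul_C, seriesEval_sub (convOnBall_affineSeries _ _)
        (convOnBall_affineSeries _ _) ht, seriesEval_affineSeries _ _ ht,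
      seriesEval_affineSeries _ _ ht] at h3
    refine ⟨_, ht, ?_⟩
    rw [add_mul, mul_assoc _ γ]
    exact sub_eq_zero.1 ((mul_eq_zero.1 h3.symm).resolve_left hc0)

theorem norm_sub_star_mul_lt {x v w : ℍ} (hx : ‖x‖ < 1) (h : ‖w‖ < ‖v‖) :
    ‖w - x * v‖ < ‖v - star x * w‖ := by
  refine lt_of_pow_lt_pow_left₀ 2 (norm_nonneg _) ?_
  have h1 : (w * star (-(x * v))).re = (v * star (-(star x * w))).re := by
    simp; ring
  have h2 := quaternion_norm_add_sq w (-(x * v))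
  have h3 := quaternion_norm_add_sq v (-(star x * w))
  rw [norm_neg, norm_mul, ← sub_eq_add_neg] at h2 h3
  rw [norm_star] at h3
  rw [h2, h3, h1]
  have h4 : ‖w‖ ^ 2 < ‖v‖ ^ 2 := pow_lt_pow_left₀ h (norm_nonneg _) two_ne_zero
  have h5 : ‖x‖ ^ 2 < 1 := by nlinarith [norm_nonneg x]
  nlinarith

/-- In the equality case of the Schwarz-Pick dichotomy the function is a regular Möbius
transformation. -/
theorem isRegularMobius_of_eq_mul_C {f : ℍ → ℍ} {p R : PowerSeries ℍ} {q₀ a u : ℍ}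
    (hf : HasRegSeries f p) (hmaps : MapsTo f unitBall unitBall) (ha : ‖a‖ < 1)
    (hq₀ : q₀ ∈ unitBall) (hpR : p - C a = (X - C q₀) * R) (hu : ‖u‖ = 1)
    (h : oneSubRight q₀ X * R * conjSeries (oneSubLeft a p) =
      oneSubLeft a p * conjSeries (oneSubLeft a p) * C u) : IsRegularMobius f := by
  have hp := hf.convOnBall
  have hp1 : ∀ q ∈ unitBall, ‖seriesEval p q‖ < 1 := fun q hq => by
    rw [← hf.eq_seriesEval hq, ← mem_unitBall]; exact hmaps hq
  have hq1 := mem_unitBall.1 hq₀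
  set D := oneSubLeft a p with hD
  have hSr := isRealSeries_mul_conjSeries D
  have hS0 : D * conjSeries D ≠ 0 := ne_zero_of_seriesEval_ne_zero
    (seriesEval_oneSubLeft_symm_ne_zero hp hp1 ha hq₀)
  have h1 : oneSubRight q₀ X * (p - C a) = (X - C q₀) * C u * D := by
    refine mul_left_cancel₀ hS0 ?_
    have h2 : oneSubRight q₀ X * (p - C a) * conjSeries D =
        D * conjSeries D * ((X - C q₀) * C u) := by
      rw [hpR, ← mul_assoc, oneSubRight, ← X_sub_C_mul_one_sub (star_comm_self' q₀).symm,
        ← oneSubRight, mul_assoc (X - C q₀), mul_assoc, h, ← mul_assoc, ← hSr.mul_comm, mul_assoc]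
    rw [← mul_assoc (D * conjSeries D) (_ * C u), ← h2, hSr.mul_comm, ← conjSeries_mul_self,
      mul_assoc _ (conjSeries D)]
  have hE : oneSubRight q₀ X = affineSeries (-star q₀) 1 := by
    rw [oneSubRight, affineSeries, map_neg, mul_neg, map_one]; abel
  have hL : (X - C q₀) * C u = affineSeries u (-(q₀ * u)) := by
    rw [affineSeries, map_neg, map_mul, sub_mul, sub_eq_add_neg]
  have hEq : affineSeries (u * star a - star q₀) (1 - q₀ * u * star a) * p =
      affineSeries (u - star q₀ * a) (a - q₀ * u) := by
    rw [hE, hL, hD, oneSubLeft, mul_sub, mul_sub, mul_one, ← mul_assoc, affineSeries_mul_C,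
      affineSeries_mul_C, sub_eq_iff_eq_add, sub_add_eq_add_sub, eq_sub_iff_add_eq, ← add_mul] at h1
    convert h1 using 2
    · simp only [affineSeries, map_sub, map_neg, mul_neg, mul_sub, neg_mul]
      abel
    · simp only [affineSeries, map_sub, map_neg, map_mul, mul_neg, mul_sub, neg_mul, one_mul]
      abel
  have hn : ∀ x : ℍ, ‖u * x‖ = ‖x‖ := fun x => by rw [norm_mul, hu, one_mul]
  have hden : ∀ q ∈ unitBall, q * (u * star a - star q₀) + (1 - q₀ * u * star a) ≠ 0 := by
    intro q hq h0
    have h2 : ‖u * star a‖ < ‖(1 : ℍ)‖ := by rw [hn, norm_star, norm_one]; exact ha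
    have h3 := norm_sub_star_mul_lt (x := star q₀) (by rwa [norm_star]) h2
    rw [star_star, mul_one, ← mul_assoc, eq_neg_of_add_eq_zero_right h0, norm_neg, norm_mul] at h3
    nlinarith [mem_unitBall.1 hq, norm_nonneg (u * star a - star q₀)]
  refine isRegularMobius_of_mul_eq hf hmaps hEq ?_ hden fun y hy => ?_
  · have hinv : ∀ x y : ℍ, x * y = y * x → 1 - x * y ≠ 0 → IsUnit !![(1 : ℍ), x; y, 1] := by
      intro x y hxy h0
      have hcx : Commute x (1 - x * y)⁻¹ :=
        ((Commute.one_right x).sub_right ((Commute.refl x).mul_right hxy)).inv_right₀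
      have hcy : Commute y (1 - x * y)⁻¹ :=
        ((Commute.one_right y).sub_right ((show Commute y x from hxy.symm).mul_right
          (Commute.refl y))).inv_right₀
      have hz := mul_inv_cancel₀ h0
      have hz' := inv_mul_cancel₀ h0
      set z := (1 - x * y)⁻¹
      refine isUnit_iff_exists.2 ⟨!![z, -(x * z); -(y * z), z], ?_, ?_⟩
      · rw [Matrix.mul_fin_two, Matrix.one_fin_two]
        have h2 : 1 * z + x * -(y * z) = 1 :=
          (by noncomm_ring : _ = (1 - x * y) * z).trans hz
        have h3 : y * -(x * z) + 1 * z = 1 := by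
          rw [mul_neg, ← mul_assoc, ← hxy]
          exact (by noncomm_ring : _ = (1 - x * y) * z).trans hz
        have h4 : 1 * -(x * z) + x * z = 0 := by noncomm_ring
        have h5 : y * z + 1 * -(y * z) = 0 := by noncomm_ring
        rw [h2, h3, h4, h5]
      · rw [Matrix.mul_fin_two, Matrix.one_fin_two]
        have h2 : z * 1 + -(x * z) * y = 1 := by
          rw [hcx.eq]
          exact (by noncomm_ring : _ = z * (1 - x * y)).trans hz'
        have h3 : -(y * z) * x + z * 1 = 1 := by
          rw [hcy.eq, neg_mul, mul_assoc, ← hxy]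
          exact (by noncomm_ring : _ = z * (1 - x * y)).trans hz'
        have h4 : z * x + -(x * z) * 1 = 0 := by rw [hcx.eq]; noncomm_ring
        have h5 : -(y * z) * 1 + z * y = 0 := by rw [hcy.eq]; noncomm_ring
        rw [h2, h3, h4, h5]
    have hu0 : u ≠ 0 := norm_ne_zero_iff.1 (by rw [hu]; exact one_ne_zero)
    have hU : IsUnit !![u, 0; 0, (1 : ℍ)] := by
      refine isUnit_iff_exists.2 ⟨!![u⁻¹, 0; 0, 1], ?_, ?_⟩ <;>
      simp [Matrix.one_fin_two, hu0]
    have hfac : !![u - star q₀ * a, u * star a - star q₀; a - q₀ * u, 1 - q₀ * u * star a] =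
        !![(1 : ℍ), -star q₀; -q₀, 1] * !![u, 0; 0, (1 : ℍ)] * !![(1 : ℍ), star a; a, 1] := by
      simp only [Matrix.mul_fin_two]
      congr 1
      simp [sub_eq_add_neg, mul_assoc, add_comm]
    rw [hfac]
    refine ((hinv _ _ ?_ ?_).mul hU).mul (hinv _ _ ?_ ?_)
    · rw [neg_mul_neg, neg_mul_neg, star_comm_self' q₀]
    · rw [neg_mul_neg]; exact one_sub_mul_ne_zero (by rwa [norm_star]) hq1
    · exact star_comm_self' a
    · exact one_sub_mul_ne_zero (by rwa [norm_star]) ha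
  · -- the linear equation for `q` has a solution in the ball
    have h2 : ‖a - y‖ < ‖u * (1 - star a * y)‖ := by
      have h3 := norm_sub_lt_norm_one_sub (x := star y) (y := star a)
        (by rw [norm_star]; exact mem_unitBall.1 hy) (by rwa [norm_star])
      rw [hn, norm_sub_rev, ← norm_star (y - a), ← norm_star (1 - star a * y)]
      simpa using h3
    have h3 := norm_sub_star_mul_lt hq1 h2
    have h4 : u - star q₀ * a - (u * star a - star q₀) * y =
        u * (1 - star a * y) - star q₀ * (a - y) := by noncomm_ring
    have h5 : a - q₀ * u - (1 - q₀ * u * star a) * y =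
        a - y - q₀ * (u * (1 - star a * y)) := by noncomm_ring
    rw [← h4, ← h5] at h3
    set m := u - star q₀ * a - (u * star a - star q₀) * y with hm
    set k := a - q₀ * u - (1 - q₀ * u * star a) * y with hk
    have hmn : 0 < ‖m‖ := (norm_nonneg k).trans_lt h3
    have hm0 : m ≠ 0 := norm_pos_iff.1 hmn
    refine ⟨-(k * m⁻¹), ?_, ?_⟩
    · rw [mem_unitBall, norm_neg, norm_mul, norm_inv, mul_inv_lt_iff₀ hmn, one_mul]
      exact h3
    · have h6 : -(k * m⁻¹) * m + k = 0 := by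
        rw [neg_mul, inv_mul_cancel_right₀ hm0, neg_add_cancel]
      rw [← sub_eq_zero, ← h6]
      generalize -(k * m⁻¹) = t
      rw [hm, hk]
      noncomm_ring

/-! ### The differential quotient -/

theorem ConvOnBall.continuousOn {p : PowerSeries ℍ} (hp : ConvOnBall p) :
    ContinuousOn (seriesEval p) unitBall := by
  intro q hq
  obtain ⟨r, hqr, hr⟩ := exists_between (mem_unitBall.1 hq)
  have h : ContinuousOn (seriesEval p) (ball (0 : ℍ) r) := by
    refine continuousOn_tsum (fun n => by fun_prop)
      (hp r ((norm_nonneg q).trans hqr.le) hr) fun n w hw => ?_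
    rw [norm_mul, norm_pow]
    gcongr
    exact (mem_ball_zero_iff.1 hw).le
  exact (h.continuousAt (isOpen_ball.mem_nhds (mem_ball_zero_iff.2 hqr))).continuousWithinAt

theorem hasRegSeries_sub_const (q₀ : ℍ) : HasRegSeries (fun w => w - q₀) (X - C q₀) :=
  hasRegSeries_X.sub (hasRegSeries_C q₀)

theorem regSymm_sub_const_ne_zero {q₀ q : ℍ} (hq : q ∈ unitBall) (h : ‖q‖ ≠ ‖q₀‖) :
    regSymm (fun w => w - q₀) q ≠ 0 := by
  have hL := convOnBall_X_sub_C q₀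
  have hne : ∀ c t : ℍ, ‖t‖ = ‖q‖ → ‖c‖ = ‖q₀‖ → t - c ≠ 0 := by
    intro c t ht hc h0
    rw [sub_eq_zero.1 h0, hc] at ht
    exact h ht.symm
  have h1 : seriesEval (X - C q₀) q ≠ 0 := by
    rw [seriesEval_X_sub_C _ hq]; exact hne _ _ rfl rfl
  rw [regSymm_eq (hasRegSeries_sub_const q₀), seriesEval_mul hL hL.conjSeries hq h1]
  refine mul_ne_zero h1 ?_
  rw [conjSeries_sub, conjSeries_X, conjSeries_C, seriesEval_X_sub_C _ (conj_mem_unitBall h1 hq)]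
  exact hne _ _ (norm_conj h1 q) (norm_star q₀)

theorem leftQuot_sub_const_eq {f : ℍ → ℍ} {p R : PowerSeries ℍ} {q₀ : ℍ} (hf : HasRegSeries f p)
    (hR : ConvOnBall R) (hpR : p - C (f q₀) = (X - C q₀) * R) {q : ℍ} (hq : q ∈ unitBall)
    (h : regSymm (fun w => w - q₀) q ≠ 0) :
    leftQuot (fun w => w - q₀) (fun w => f w - f q₀) q = seriesEval R q := by
  have hL := convOnBall_X_sub_C q₀
  rw [regSymm_eq (hasRegSeries_sub_const q₀)] at h
  rw [leftQuot_eq (hasRegSeries_sub_const q₀) (hf.sub (hasRegSeries_C (f q₀))), hpR, ← mul_assoc,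
    conjSeries_mul_self, (isRealSeries_mul_conjSeries _).seriesEval_mul (hL.mul hL.conjSeries) hR hq,
    inv_mul_cancel_left₀ h]

/-- The differential quotient is the cofactor of `q - q₀` in `f - f(q₀)`. -/
theorem diffQuot_eqOn {f : ℍ → ℍ} {p R : PowerSeries ℍ} {q₀ : ℍ} (hf : HasRegSeries f p)
    (hR : ConvOnBall R) (hpR : p - C (f q₀) = (X - C q₀) * R) :
    EqOn (diffQuot f q₀) (seriesEval R) unitBall := by
  intro q hq
  refine extendFrom_eq ?_ ?_
  · have hd : Dense (sphere (0 : ℍ) ‖q₀‖)ᶜ :=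
      interior_eq_empty_iff_dense_compl.1 (interior_sphere' 0 _)
    refine closure_mono ?_ (hd.open_subset_closure_inter isOpen_ball hq)
    rintro w ⟨hw, hw'⟩
    exact ⟨hw, regSymm_sub_const_ne_zero hw fun h => hw' (mem_sphere_zero_iff_norm.2 h)⟩
  · have hsub : {q | q ∈ unitBall ∧ regSymm (fun w => w - q₀) q ≠ 0} ⊆ unitBall := fun _ h => h.1
    refine ((hR.continuousOn q hq).mono_left (nhdsWithin_mono q hsub)).congr' ?_
    filter_upwards [self_mem_nhdsWithin] with w hw
    exact (leftQuot_sub_const_eq hf hR hpR hw.1 hw.2).symm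

theorem hasRegSeries_oneSubConjMul {f : ℍ → ℍ} {p : PowerSeries ℍ} (hf : HasRegSeries f p)
    (a : ℍ) : HasRegSeries (oneSubConjMul a f) (oneSubLeft a p) := by
  have h : oneSubConjMul a f = fun q => 1 - seriesEval (C (star a) * p) q := by
    funext q
    rw [oneSubConjMul, starMul, (hasRegSeries_C (star a)).regSeries_eq, hf.regSeries_eq]
  rw [h]
  exact hasRegSeries_one.sub ((convOnBall_C _).mul hf.convOnBall).hasRegSeries

theorem sphericalDeriv_eq {f : ℍ → ℍ} {p R : PowerSeries ℍ} {q₀ : ℍ} (hf : HasRegSeries f p)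
    (hR : ConvOnBall R) (hq₀ : q₀ ∈ unitBall) (hpR : p - C (f q₀) = (X - C q₀) * R) :
    sphericalDeriv f q₀ = seriesEval R (star q₀) := by
  have hs₀ := star_mem_unitBall hq₀
  by_cases him : q₀.im = 0
  · have hreal : star q₀ = q₀ := by
      rw [Quaternion.star_eq_self, ← sub_eq_zero, Quaternion.sub_re_self, him]
    rw [sphericalDeriv, if_pos him, hreal, hf.cullenDeriv.eq_seriesEval hq₀]
    simpa using seriesEval_seriesDeriv_mul hR.hasRegSeries.cullenDeriv.convOnBall hR hq₀ hpR
      convOnBall_one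
  · have h1 := seriesEval_eq_sub_mul hf.convOnBall hR hpR hs₀ (commute_star_self q₀)
    have h2 : star q₀ - q₀ = -(2 * q₀.im) := by
      conv_lhs => rw [← Quaternion.re_add_im q₀]
      rw [star_add, Quaternion.star_coe, Quaternion.star_im]
      noncomm_ring
    have h3 : (2 * q₀.im : ℍ) ≠ 0 := by
      rw [two_mul, ← two_smul ℝ]; exact smul_ne_zero two_ne_zero him
    rw [← hf.eq_seriesEval hs₀, h2, neg_mul, ← neg_sub, neg_inj] at h1
    rw [sphericalDeriv, if_neg him, h1, inv_mul_cancel_left₀ h3]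

/-! ### The Schwarz-Pick lemma -/

/-- Each of the four left-hand sides of the Schwarz-Pick lemma is the corresponding right-hand side
multiplied by the modulus, at some point of the ball, of the quotient in the dichotomy. -/
theorem exists_schwarzPick_factor {f : ℍ → ℍ} {p R : PowerSeries ℍ} {q₀ : ℍ}
    (hf : HasRegSeries f p) (hmaps : MapsTo f unitBall unitBall) (hq₀ : q₀ ∈ unitBall)
    (hR : ConvOnBall R) (hpR : p - C (f q₀) = (X - C q₀) * R) :
    let ρ : ℍ → ℝ := fun q =>
      ‖seriesEval (oneSubRight q₀ X * R * conjSeries (oneSubLeft (f q₀) p)) q‖ /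
        ‖seriesEval (oneSubLeft (f q₀) p * conjSeries (oneSubLeft (f q₀) p)) q‖
    (∀ q ∈ unitBall, ∃ q' ∈ unitBall,
      ‖rightQuot (fun w => f w - f q₀) (oneSubConjMul (f q₀) f) q‖ =
        ‖rightQuot (fun w => w - q₀) (oneSubConjMul q₀ id) q‖ * ρ q') ∧
    (∀ q ∈ unitBall, ∃ q' ∈ unitBall,
      ‖rightQuot (diffQuot f q₀) (oneSubConjMul (f q₀) f) q‖ =
        ‖regInv (oneSubConjMul q₀ id) q‖ * ρ q') ∧
    (∃ q' ∈ unitBall, ‖rightQuot (cullenDeriv f) (oneSubConjMul (f q₀) f) q₀‖ =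
      1 / (1 - ‖q₀‖ ^ 2) * ρ q') ∧
    (∃ q' ∈ unitBall, ‖sphericalDeriv f q₀‖ / ‖1 - regSymm f q₀‖ =
      1 / ‖1 - (star q₀) ^ 2‖ * ρ q') := by
  intro ρ
  have hp := hf.convOnBall
  have hp1 : ∀ q ∈ unitBall, ‖seriesEval p q‖ < 1 := fun q hq => by
    rw [← hf.eq_seriesEval hq, ← mem_unitBall]; exact hmaps hq
  have ha : ‖f q₀‖ < 1 := mem_unitBall.1 (hmaps hq₀)
  have hq1 := mem_unitBall.1 hq₀
  have hs₀ := star_mem_unitBall hq₀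
  have hfa : f q₀ = seriesEval p q₀ := hf.eq_seriesEval hq₀
  have hdiff : HasRegSeries (diffQuot f q₀) R := hR.hasRegSeries.congr (diffQuot_eqOn hf hR hpR)
  have hD := hasRegSeries_oneSubConjMul hf (f q₀)
  have hE := hasRegSeries_oneSubConjMul (f := id) hasRegSeries_X q₀
  rw [oneSubLeft_X] at hE
  have hL := convOnBall_X_sub_C q₀
  have hDc := hD.convOnBall
  have hEc := hE.convOnBall
  have hN : ConvOnBall (oneSubRight q₀ X * R * conjSeries (oneSubLeft (f q₀) p)) :=
    (hEc.mul hR).mul hDc.conjSeries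
  have hSc := hDc.mul hDc.conjSeries
  have hSr := isRealSeries_mul_conjSeries (oneSubLeft (f q₀) p)
  have hZc := hEc.mul hEc.conjSeries
  have hZr := isRealSeries_mul_conjSeries (oneSubRight q₀ X)
  have hS0 : ∀ q ∈ unitBall,
      seriesEval (oneSubLeft (f q₀) p * conjSeries (oneSubLeft (f q₀) p)) q ≠ 0 :=
    fun q hq => seriesEval_oneSubLeft_symm_ne_zero hp hp1 ha hq
  have h2 : ∀ q ∈ unitBall, ∃ q' ∈ unitBall,
      ‖rightQuot (diffQuot f q₀) (oneSubConjMul (f q₀) f) q‖ =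
        ‖regInv (oneSubConjMul q₀ id) q‖ * ρ q' := by
    intro q hq
    rw [rightQuot_eq hD hdiff, regInv, leftQuot_eq hE hasRegSeries_one, mul_one]
    refine exists_norm_div_eq hEc.conjSeries hN hZc (hR.mul hDc.conjSeries) hSc hZr hSr ?_ hq
      (seriesEval_oneSubRight_X_symm_ne_zero hq₀ hq)
    rw [← conjSeries_mul_self (oneSubRight q₀ X)]
    simp only [mul_assoc]
  have hinv : ∀ q ∈ unitBall, Commute q q₀ →
      ‖regInv (oneSubConjMul q₀ id) q‖ = 1 / ‖1 - q * star q₀‖ := by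
    intro q hq hc
    rw [regInv, leftQuot_eq hE hasRegSeries_one, mul_one,
      symm_inv_mul_conjSeries_oneSubRight_X hq₀ hq hc, norm_inv, one_div]
  refine ⟨fun q hq => ?_, h2, ?_, ?_⟩
  · rw [rightQuot_eq hD (hf.sub (hasRegSeries_C (f q₀))),
      rightQuot_eq hE (hasRegSeries_sub_const q₀)]
    refine exists_norm_div_eq (hL.mul hEc.conjSeries) hN hZc
      ((hp.sub (convOnBall_C (f q₀))).mul hDc.conjSeries) hSc hZr hSr ?_ hq
      (seriesEval_oneSubRight_X_symm_ne_zero hq₀ hq)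
    have hz := hZr.mul_comm (X - C q₀)
    rw [← conjSeries_mul_self] at hz
    rw [hpR, ← conjSeries_mul_self (oneSubRight q₀ X), mul_assoc (X - C q₀) R,
      ← mul_assoc _ (X - C q₀), hz]
    simp only [mul_assoc]
  · obtain ⟨q', hq', heq⟩ := h2 q₀ hq₀
    refine ⟨q', hq', ?_⟩
    have h1 : ‖1 - q₀ * star q₀‖ = 1 - ‖q₀‖ ^ 2 := by
      rw [← coe_norm_sq, ← Quaternion.coe_one, ← Quaternion.coe_sub, Quaternion.norm_coe,
        Real.norm_of_nonneg (by nlinarith [norm_nonneg q₀])]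
    rw [hinv q₀ hq₀ (Commute.refl _), h1, rightQuot_eq hD hdiff] at heq
    rw [rightQuot_eq hD hf.cullenDeriv, seriesEval_seriesDeriv_mul
      hR.hasRegSeries.cullenDeriv.convOnBall hR hq₀ hpR hDc.conjSeries, heq]
  · obtain ⟨q', hq', heq⟩ := h2 (star q₀) hs₀
    refine ⟨q', hq', ?_⟩
    rw [hinv _ hs₀ (commute_star_self q₀), ← pow_two, rightQuot_eq hD hdiff,
      hSr.seriesEval_star hSc hq₀] at heq
    rw [← heq, sphericalDeriv_eq hf hR hq₀ hpR, regSymm_eq hf, norm_mul, norm_inv, norm_star]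
    have h0 : (1 - ‖f q₀‖ ^ 2) ≠ 0 := by nlinarith [norm_nonneg (f q₀)]
    rw [hfa] at h0 hpR ⊢
    rw [seriesEval_oneSubLeft_symm_self hp hq₀,
      seriesEval_mul_conjSeries_oneSubLeft_star hp hR hq₀ hpR, norm_mul, norm_mul,
      Quaternion.norm_coe]
    have h1 : ‖1 - ‖seriesEval p q₀‖ ^ 2‖ ≠ 0 := norm_ne_zero_iff.2 h0
    rw [inv_mul_eq_div, mul_div_mul_right _ _ h1]

theorem schwarzPick_wellDefined {f : ℍ → ℍ} {p R : PowerSeries ℍ} {q₀ : ℍ}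
    (hf : HasRegSeries f p) (hmaps : MapsTo f unitBall unitBall) (hq₀ : q₀ ∈ unitBall)
    (hR : ConvOnBall R) (hpR : p - C (f q₀) = (X - C q₀) * R) :
    (∀ q ∈ unitBall, regSymm (oneSubConjMul (f q₀) f) q ≠ 0) ∧
    (∀ q ∈ unitBall, regSymm (oneSubConjMul q₀ id) q ≠ 0) ∧
    (SliceRegularOn (diffQuot f q₀) unitBall ∧
      ∀ q ∈ unitBall, regSymm (fun w => w - q₀) q ≠ 0 →
        diffQuot f q₀ q = leftQuot (fun w => w - q₀) (fun w => f w - f q₀) q) ∧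
    1 - regSymm f q₀ ≠ 0 := by
  have hp := hf.convOnBall
  have hp1 : ∀ q ∈ unitBall, ‖seriesEval p q‖ < 1 := fun q hq => by
    rw [← hf.eq_seriesEval hq, ← mem_unitBall]; exact hmaps hq
  have ha : ‖f q₀‖ < 1 := mem_unitBall.1 (hmaps hq₀)
  have hdiff := diffQuot_eqOn hf hR hpR
  refine ⟨fun q hq => ?_, fun q hq => ?_, ⟨(hR.hasRegSeries.congr hdiff).sliceRegularOn,
    fun q hq h => ?_⟩, fun h => ?_⟩
  · rw [regSymm_eq (hasRegSeries_oneSubConjMul hf (f q₀))]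
    exact seriesEval_oneSubLeft_symm_ne_zero hp hp1 ha hq
  · rw [regSymm_eq (hasRegSeries_oneSubConjMul (f := id) hasRegSeries_X q₀), oneSubLeft_X]
    exact seriesEval_oneSubRight_X_symm_ne_zero hq₀ hq
  · rw [leftQuot_sub_const_eq hf hR hpR hq h, hdiff hq]
  · rw [regSymm_eq hf] at h
    refine seriesEval_oneSubLeft_symm_ne_zero hp hp1 ha hq₀ ?_
    rw [hf.eq_seriesEval hq₀, seriesEval_oneSubLeft_symm_self hp hq₀, h, zero_mul]

/-- The Möbius transform of the variable vanishes only at `q₀`. -/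
theorem rightQuot_sub_const_ne_zero {q₀ q : ℍ} (hq₀ : q₀ ∈ unitBall) (hq : q ∈ unitBall)
    (hne : q ≠ q₀) : rightQuot (fun w => w - q₀) (oneSubConjMul q₀ id) q ≠ 0 := by
  have hE := hasRegSeries_oneSubConjMul (f := id) hasRegSeries_X q₀
  rw [oneSubLeft_X] at hE
  rw [rightQuot_eq hE (hasRegSeries_sub_const q₀)]
  obtain ⟨c, hc, heq⟩ :=
    exists_seriesEval_mul (convOnBall_X_sub_C q₀) hE.convOnBall.conjSeries hq
  rw [heq, seriesEval_X_sub_C _ hq, conjSeries_oneSubRight_X,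
    seriesEval_oneSubRight_X _ (conj_mem_unitBall hc hq), star_star, ← conjSeries_oneSubRight_X]
  exact mul_ne_zero (inv_ne_zero (seriesEval_oneSubRight_X_symm_ne_zero hq₀ hq))
    (mul_ne_zero (sub_ne_zero.2 hne) (one_sub_mul_ne_zero
      (mem_unitBall.1 (conj_mem_unitBall hc hq)) (mem_unitBall.1 hq₀)))

theorem regInv_oneSubConjMul_id_ne_zero {q₀ q : ℍ} (hq₀ : q₀ ∈ unitBall) (hq : q ∈ unitBall) :
    regInv (oneSubConjMul q₀ id) q ≠ 0 := by
  have hE := hasRegSeries_oneSubConjMul (f := id) hasRegSeries_X q₀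
  rw [oneSubLeft_X] at hE
  have h1 : seriesEval (conjSeries (oneSubRight q₀ X)) q ≠ 0 := by
    rw [conjSeries_oneSubRight_X, seriesEval_oneSubRight_X _ hq, star_star]
    exact one_sub_mul_ne_zero (mem_unitBall.1 hq) (mem_unitBall.1 hq₀)
  rw [regInv, leftQuot_eq hE hasRegSeries_one, mul_one]
  exact mul_ne_zero (inv_ne_zero (seriesEval_oneSubRight_X_symm_ne_zero hq₀ hq)) h1

theorem rightQuot_eq_zero {f g : ℍ → ℍ} {p R : PowerSeries ℍ} {q₀ : ℍ} (hf : HasRegSeries f p)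
    (hg : HasRegSeries g ((X - C q₀) * R)) (hR : ConvOnBall R) (hq₀ : q₀ ∈ unitBall) :
    rightQuot g f q₀ = 0 := by
  rw [rightQuot_eq hf hg, mul_assoc, seriesEval_mul_eq_zero (convOnBall_X_sub_C q₀)
    (hR.mul hf.convOnBall.conjSeries) hq₀ (by rw [seriesEval_X_sub_C _ hq₀, sub_self]), mul_zero]

theorem schwarzPick_factor_dichotomy {f : ℍ → ℍ} {p R : PowerSeries ℍ} {q₀ : ℍ}
    (hf : HasRegSeries f p) (hmaps : MapsTo f unitBall unitBall) (hq₀ : q₀ ∈ unitBall)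
    (hR : ConvOnBall R) (hpR : p - C (f q₀) = (X - C q₀) * R) :
    let ρ : ℍ → ℝ := fun q =>
      ‖seriesEval (oneSubRight q₀ X * R * conjSeries (oneSubLeft (f q₀) p)) q‖ /
        ‖seriesEval (oneSubLeft (f q₀) p * conjSeries (oneSubLeft (f q₀) p)) q‖
    (IsRegularMobius f → ∀ q ∈ unitBall, ρ q = 1) ∧
    (¬ IsRegularMobius f → ∀ q ∈ unitBall, ρ q < 1) := by
  intro ρ
  have hp := hf.convOnBall
  have hp1 : ∀ q ∈ unitBall, ‖seriesEval p q‖ < 1 := fun q hq => by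
    rw [← hf.eq_seriesEval hq, ← mem_unitBall]; exact hmaps hq
  have ha : ‖f q₀‖ < 1 := mem_unitBall.1 (hmaps hq₀)
  have hDc := hp.oneSubLeft (f q₀)
  have hS0 : ∀ q ∈ unitBall, 0 < ‖seriesEval
      (oneSubLeft (f q₀) p * conjSeries (oneSubLeft (f q₀) p)) q‖ :=
    fun q hq => norm_pos_iff.2 (seriesEval_oneSubLeft_symm_ne_zero hp hp1 ha hq)
  refine ⟨fun hM q hq => ?_, fun hM q hq => ?_⟩
  · obtain ⟨u, hu, hN⟩ := hM.eq_mul_C hf ha hq₀ hR hpR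
    simp only [ρ]
    rw [hN, seriesEval_mul_C (hDc.mul hDc.conjSeries) u hq, norm_mul, hu, mul_one,
      div_self (hS0 q hq).ne']
  · have hlt := (schwarzPick_dichotomy hp hp1 ha hq₀ hR hpR).resolve_right
      fun ⟨u, hu, hN⟩ => hM (isRegularMobius_of_eq_mul_C hf hmaps ha hq₀ hpR hu hN)
    exact (div_lt_one (hS0 q hq)).2 (hlt q hq)

/-- The conclusions of the Schwarz-Pick lemma, with the comparison to the right-hand sides
expressed by a single factor `ρ`. -/
theorem schwarzPick_aux {f : ℍ → ℍ} (hf : SliceRegularOn f unitBall)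
    (hmaps : MapsTo f unitBall unitBall) {q₀ : ℍ} (hq₀ : q₀ ∈ unitBall) :
    ((∀ q ∈ unitBall, regSymm (oneSubConjMul (f q₀) f) q ≠ 0) ∧
      (∀ q ∈ unitBall, regSymm (oneSubConjMul q₀ id) q ≠ 0) ∧
      (SliceRegularOn (diffQuot f q₀) unitBall ∧
        ∀ q ∈ unitBall, regSymm (fun w => w - q₀) q ≠ 0 →
          diffQuot f q₀ q = leftQuot (fun w => w - q₀) (fun w => f w - f q₀) q) ∧
      1 - regSymm f q₀ ≠ 0) ∧
    (rightQuot (fun w => f w - f q₀) (oneSubConjMul (f q₀) f) q₀ = 0 ∧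
      rightQuot (fun w => w - q₀) (oneSubConjMul q₀ id) q₀ = 0) ∧
    ∃ ρ : ℍ → ℝ, ((IsRegularMobius f → ∀ q ∈ unitBall, ρ q = 1) ∧
        (¬ IsRegularMobius f → ∀ q ∈ unitBall, ρ q < 1)) ∧
      (∀ q ∈ unitBall, ∃ q' ∈ unitBall,
        ‖rightQuot (fun w => f w - f q₀) (oneSubConjMul (f q₀) f) q‖ =
          ‖rightQuot (fun w => w - q₀) (oneSubConjMul q₀ id) q‖ * ρ q') ∧
      (∀ q ∈ unitBall, ∃ q' ∈ unitBall,
        ‖rightQuot (diffQuot f q₀) (oneSubConjMul (f q₀) f) q‖ =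
          ‖regInv (oneSubConjMul q₀ id) q‖ * ρ q') ∧
      (∃ q' ∈ unitBall, ‖rightQuot (cullenDeriv f) (oneSubConjMul (f q₀) f) q₀‖ =
        1 / (1 - ‖q₀‖ ^ 2) * ρ q') ∧
      (∃ q' ∈ unitBall, ‖sphericalDeriv f q₀‖ / ‖1 - regSymm f q₀‖ =
        1 / ‖1 - (star q₀) ^ 2‖ * ρ q') := by
  obtain ⟨p, hf'⟩ := hf.exists_hasRegSeries
  have hp := hf'.convOnBall
  obtain ⟨R, hR, hpR⟩ := (hp.sub (convOnBall_C (f q₀))).exists_eq_X_sub_C_mul hq₀ (by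
    rw [seriesEval_sub hp (convOnBall_C _) hq₀, seriesEval_C _ hq₀, ← hf'.eq_seriesEval hq₀,
      sub_self])
  refine ⟨schwarzPick_wellDefined hf' hmaps hq₀ hR hpR,
    ⟨rightQuot_eq_zero (hasRegSeries_oneSubConjMul hf' (f q₀))
        (hpR ▸ hf'.sub (hasRegSeries_C (f q₀))) hR hq₀,
      rightQuot_eq_zero (R := 1) (hasRegSeries_oneSubConjMul (f := id) hasRegSeries_X q₀)
        ((mul_one (X - C q₀ : PowerSeries ℍ)).symm ▸ hasRegSeries_sub_const q₀)
        convOnBall_one hq₀⟩,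
    _, schwarzPick_factor_dichotomy hf' hmaps hq₀ hR hpR,
    exists_schwarzPick_factor hf' hmaps hq₀ hR hpR⟩

end

theorem mainTheorem1 (f : Quaternion ℝ → Quaternion ℝ) (hf : SliceRegularOn f unitBall)
    (hmaps : MapsTo f unitBall unitBall) (q₀ : Quaternion ℝ) (hq₀ : q₀ ∈ unitBall) :
    -- all the objects are well defined on the ball
    (∀ q ∈ unitBall, regSymm (oneSubConjMul (f q₀) f) q ≠ 0) ∧
    (∀ q ∈ unitBall, regSymm (oneSubConjMul q₀ id) q ≠ 0) ∧
    (SliceRegularOn (diffQuot f q₀) unitBall ∧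
      ∀ q ∈ unitBall, regSymm (fun w => w - q₀) q ≠ 0 →
        diffQuot f q₀ q = leftQuot (fun w => w - q₀) (fun w => f w - f q₀) q) ∧
    1 - regSymm f q₀ ≠ 0 ∧
    -- the inequalities
    (∀ q ∈ unitBall,
      ‖rightQuot (fun w => f w - f q₀) (oneSubConjMul (f q₀) f) q‖ ≤
        ‖rightQuot (fun w => w - q₀) (oneSubConjMul q₀ id) q‖) ∧
    (∀ q ∈ unitBall,
      ‖rightQuot (diffQuot f q₀) (oneSubConjMul (f q₀) f) q‖ ≤
        ‖regInv (oneSubConjMul q₀ id) q‖) ∧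
    ‖rightQuot (cullenDeriv f) (oneSubConjMul (f q₀) f) q₀‖ ≤ 1 / (1 - ‖q₀‖ ^ 2) ∧
    ‖sphericalDeriv f q₀‖ / ‖1 - regSymm f q₀‖ ≤ 1 / ‖1 - (star q₀) ^ 2‖ ∧
    -- equality for regular Moebius transformations
    (IsRegularMobius f →
      (∀ q ∈ unitBall,
        ‖rightQuot (fun w => f w - f q₀) (oneSubConjMul (f q₀) f) q‖ =
          ‖rightQuot (fun w => w - q₀) (oneSubConjMul q₀ id) q‖) ∧
      (∀ q ∈ unitBall,
        ‖rightQuot (diffQuot f q₀) (oneSubConjMul (f q₀) f) q‖ =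
          ‖regInv (oneSubConjMul q₀ id) q‖) ∧
      ‖rightQuot (cullenDeriv f) (oneSubConjMul (f q₀) f) q₀‖ = 1 / (1 - ‖q₀‖ ^ 2) ∧
      ‖sphericalDeriv f q₀‖ / ‖1 - regSymm f q₀‖ = 1 / ‖1 - (star q₀) ^ 2‖) ∧
    -- strict inequalities otherwise, except for the first one at `q₀`, where both sides vanish
    (¬ IsRegularMobius f →
      (∀ q ∈ unitBall, q ≠ q₀ →
        ‖rightQuot (fun w => f w - f q₀) (oneSubConjMul (f q₀) f) q‖ <
          ‖rightQuot (fun w => w - q₀) (oneSubConjMul q₀ id) q‖) ∧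
      (∀ q ∈ unitBall,
        ‖rightQuot (diffQuot f q₀) (oneSubConjMul (f q₀) f) q‖ <
          ‖regInv (oneSubConjMul q₀ id) q‖) ∧
      ‖rightQuot (cullenDeriv f) (oneSubConjMul (f q₀) f) q₀‖ < 1 / (1 - ‖q₀‖ ^ 2) ∧
      ‖sphericalDeriv f q₀‖ / ‖1 - regSymm f q₀‖ < 1 / ‖1 - (star q₀) ^ 2‖) ∧
    rightQuot (fun w => f w - f q₀) (oneSubConjMul (f q₀) f) q₀ = 0 ∧
    rightQuot (fun w => w - q₀) (oneSubConjMul q₀ id) q₀ = 0 := by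
  obtain ⟨⟨hw1, hw2, hw3, hw4⟩, ⟨hzero1, hzero2⟩, ρ, ⟨hρ1, hρ2⟩, h1, h2, ⟨q3, hq3, h3⟩,
    ⟨q4, hq4, h4⟩⟩ := schwarzPick_aux hf hmaps hq₀
  have hq1 := mem_unitBall.1 hq₀
  have hpos1 := fun q (hq : q ∈ unitBall) hne =>
    norm_pos_iff.2 (rightQuot_sub_const_ne_zero hq₀ hq hne)
  have hpos2 := fun q (hq : q ∈ unitBall) =>
    norm_pos_iff.2 (regInv_oneSubConjMul_id_ne_zero hq₀ hq)
  have hpos3 : 0 < 1 / (1 - ‖q₀‖ ^ 2) := one_div_pos.2 (by nlinarith [norm_nonneg q₀])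
  have hpos4 : 0 < 1 / ‖1 - (star q₀) ^ 2‖ := by
    rw [pow_two]
    exact one_div_pos.2 (norm_pos_iff.2
      (one_sub_mul_ne_zero (by rwa [norm_star]) (by rwa [norm_star])))
  refine ⟨hw1, hw2, hw3, hw4, ?_⟩
  by_cases hM : IsRegularMobius f
  · have hρ := hρ1 hM
    have e1 : ∀ q ∈ unitBall, ‖rightQuot (fun w => f w - f q₀) (oneSubConjMul (f q₀) f) q‖ =
        ‖rightQuot (fun w => w - q₀) (oneSubConjMul q₀ id) q‖ := fun q hq => by
      obtain ⟨q', hq', h⟩ := h1 q hq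
      rw [h, hρ q' hq', mul_one]
    have e2 : ∀ q ∈ unitBall, ‖rightQuot (diffQuot f q₀) (oneSubConjMul (f q₀) f) q‖ =
        ‖regInv (oneSubConjMul q₀ id) q‖ := fun q hq => by
      obtain ⟨q', hq', h⟩ := h2 q hq
      rw [h, hρ q' hq', mul_one]
    rw [hρ q3 hq3, mul_one] at h3
    rw [hρ q4 hq4, mul_one] at h4
    exact ⟨fun q hq => (e1 q hq).le, fun q hq => (e2 q hq).le, h3.le, h4.le,
      fun _ => ⟨e1, e2, h3, h4⟩, fun h => absurd hM h, hzero1, hzero2⟩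
  · have hρ := hρ2 hM
    have l1 : ∀ q ∈ unitBall, q ≠ q₀ →
        ‖rightQuot (fun w => f w - f q₀) (oneSubConjMul (f q₀) f) q‖ <
          ‖rightQuot (fun w => w - q₀) (oneSubConjMul q₀ id) q‖ := fun q hq hne => by
      obtain ⟨q', hq', h⟩ := h1 q hq
      rw [h]
      exact mul_lt_of_lt_one_right (hpos1 q hq hne) (hρ q' hq')
    have l2 : ∀ q ∈ unitBall, ‖rightQuot (diffQuot f q₀) (oneSubConjMul (f q₀) f) q‖ <
        ‖regInv (oneSubConjMul q₀ id) q‖ := fun q hq => by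
      obtain ⟨q', hq', h⟩ := h2 q hq
      rw [h]
      exact mul_lt_of_lt_one_right (hpos2 q hq) (hρ q' hq')
    have l3 := mul_lt_of_lt_one_right hpos3 (hρ q3 hq3)
    have l4 := mul_lt_of_lt_one_right hpos4 (hρ q4 hq4)
    rw [← h3] at l3
    rw [← h4] at l4
    refine ⟨fun q hq => ?_, fun q hq => (l2 q hq).le, l3.le, l4.le,
      fun h => absurd h hM, fun _ => ⟨l1, l2, l3, l4⟩, hzero1, hzero2⟩
    rcases eq_or_ne q q₀ with rfl | hne
    · rw [hzero1, hzero2]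
    · exact (l1 q hq hne).le
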